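/- For $k\ge 0$ let $\mathcal B_k$ be the strict monoidal category $(\mathcal B_k,\sqcup,())$ whose objects are the finite words in the symbols $0,\dots,k$ (with $\sqcup$ concatenation) and whose morphisms are freely generated under composition and $\sqcup$ by $u^a\colon()\to(a)$ and $m^a\colon(a,a)\to(a)$ for $0\le a\le k$ and $t^{a,b}\colon(a,b)\to(b,a)$ for $0\le b<a\le k$, subject to the relations (R1) $m^a\circ(\mathrm{id}_{(a)}\sqcup u^a)=\mathrm{id}_{(a)}=m^a\circ(u^a\sqcup\mathrm{id}_{(a)})$ and (R2) $t^{c,d}\circ(\mathrm{id}_{(c)}\sqcup u^d)=u^d\sqcup\mathrm{id}_{(c)}$, $t^{c,d}\circ(u^c\sqcup\mathrm{id}_{(d)})=\mathrm{id}_{(d)}\sqcup u^c$ for $d<c$. The categories $\mathcal B_k$ form a simplicial monoidal category: the face $d_i$ deletes the symbol $i$ (and renumbers the others), sending $u^i,m^i$ to $\mathrm{id}_{()}$ and $t^{c,d}$ with $i\in\{c,d\}$ to an identity; the degeneracy $s_i$ replaces the symbol $i$ by two consecutive symbols $i',i''$ (and renumbers the others), sending $u^i$ to $u^{i'}\sqcup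 u^{i''}$, $m^i$ to $(m^{i'}\sqcup m^{i''})\circ(\mathrm{id}_{(i')}\sqcup t^{i'',i'}\sqcup\mathrm{id}_{(i'')})$, $t^{i,d}$ to $(t^{i',d}\sqcup\mathrm{id}_{(i'')})\circ(\mathrm{id}_{(i')}\sqcup t^{i'',d})$ and $t^{c,i}$ to $(\mathrm{id}_{(i')}\sqcup t^{c,i''})\circ(t^{c,i'}\sqcup\mathrm{id}_{(i'')})$. Write $[k]$ for the word $(0,1,\dots,k)$ and $[k]^n$ for its $n$-fold concatenation, and let $\mathrm{TW}(n)$ be the simplicial set with $\mathrm{TW}(n)_k=\mathrm{Hom}_{\mathcal B_k}([k]^n,[k])$ and the induced operators. **Theorem.** (i) With the unit $\mathrm{id}_{[k]}\in\mathrm{TW}(1)_k$ and the composition $(x;y_1,\dots,y_n)\mapsto x\circ(y_1\sqcup\dots\sqcup y_n)$, $\mathrm{TW}(n)\times\prod_{i=1}^n\mathrm{TW}(m_i)\to\mathrm{TW}(\sum_i m_i)$, the sequence $(\mathrm{TW}(n))_{n\ge0}$ is a nonsymmetric operad of simplicial sets, and for every $n\ge0$ the simplicial set $\mathrm{TW}(n)$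 is contractible (simplicially homotopy equivalent to a point). That is, $\mathrm{TW}$ is a nonsymmetric $A_\infty$-operad. (ii) Let $n\ge2$. Define $\beta_n\colon[1]^n\to(0\,1^n)$ in $\mathcal B_1$ by $\beta_2=(m^0\sqcup\mathrm{id}_{(11)})\circ(\mathrm{id}_{(0)}\sqcup t^{1,0}\sqcup\mathrm{id}_{(1)})$ and $\beta_n=(\beta_{n-1}\sqcup\mathrm{id}_{(1)})\circ(\mathrm{id}_{[1]^{n-2}}\sqcup\beta_2)$ for $n\ge 3$, and let $d^0\colon\mathcal B_k\to\mathcal B_{k+1}$ be the monoidal functor which raises all labels by one. Then $s_{-1}(*)=d_1\beta_n\in\mathrm{TW}(n)_0$ and $s_{-1}(\varphi)=(\mathrm{id}_{(0)}\sqcup d^0\varphi)\circ s_1^{k}\beta_n\in\mathrm{TW}(n)_{k+1}$ for $\varphi\in\mathrm{TW}(n)_k$, $k\ge0$, define a left contraction of $\mathrm{TW}(n)$ augmented to a point $\mathrm{TW}(n)_{-1}=\{*\}$: $d_0s_{-1}=\mathrm{id}$, $d_is_{-1}=s_{-1}d_{i-1}$ for $i\ge1$, and $s_is_{-1}=s_{-1}s_{i-1}$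 for $i\ge0$. -/

import Mathlib

namespace TwistOperad

/-- Words in the symbols `0, …, k`: the objects of `B_k`. -/
abbrev Word (k : ℕ) := List (Fin (k + 1))

/-- Formal expressions for the morphisms of the free (strict) monoidal category on the generators
`u^a : () → (a)`, `m^a : (a,a) → (a)` and, for `b < a`, `t^{a,b} : (a,b) → (b,a)`.
`comp f g` is "first `f`, then `g`", that is `g ∘ f`; `tensor` is `⊔`. -/
inductive Diagram (k : ℕ) : Word k → Word k → Type
  | id (σ : Word k) : Diagram k σ σ
  | u (a : Fin (k + 1)) : Diagram k [] [a]
  | m (a : Fin (k + 1)) : Diagram k [a, a] [a]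
  | t (a b : Fin (k + 1)) (h : b < a) : Diagram k [a, b] [b, a]
  | comp {σ τ ρ : Word k} (f : Diagram k σ τ) (g : Diagram k τ ρ) : Diagram k σ ρ
  | tensor {σ τ σ' τ' : Word k} (f : Diagram k σ τ) (g : Diagram k σ' τ') : Diagram k (σ ++ σ') (τ ++ τ')

/-- The congruence on formal expressions generated by the axioms of a strict monoidal category
and the relations that `u` is a two-sided unit for `m` and that `t` is compatible with `u`. -/
inductive Eqv {k : ℕ} : ∀ {σ τ σ' τ' : Word k}, Diagram k σ τ → Diagram k σ' τ' → Prop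
  | refl {σ τ : Word k} (f : Diagram k σ τ) : Eqv f f
  | symm {σ τ σ' τ' : Word k} {f : Diagram k σ τ} {g : Diagram k σ' τ'} : Eqv f g → Eqv g f
  | trans {σ τ σ' τ' σ'' τ'' : Word k} {f : Diagram k σ τ} {g : Diagram k σ' τ'} {h : Diagram k σ'' τ''} :
      Eqv f g → Eqv g h → Eqv f h
  | comp_congr {σ τ ρ σ' τ' ρ' : Word k} {f : Diagram k σ τ} {g : Diagram k τ ρ}
      {f' : Diagram k σ' τ'} {g' : Diagram k τ' ρ'} :
      Eqv f f' → Eqv g g' → Eqv (f.comp g) (f'.comp g')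
  | tensor_congr {σ τ σ' τ' σ₁ τ₁ σ₁' τ₁' : Word k} {f : Diagram k σ τ} {g : Diagram k σ' τ'}
      {f' : Diagram k σ₁ τ₁} {g' : Diagram k σ₁' τ₁'} :
      Eqv f f' → Eqv g g' → Eqv (f.tensor g) (f'.tensor g')
  | id_comp {σ τ : Word k} (f : Diagram k σ τ) : Eqv ((Diagram.id σ).comp f) f
  | comp_id {σ τ : Word k} (f : Diagram k σ τ) : Eqv (f.comp (Diagram.id τ)) f
  | assoc {σ τ ρ υ : Word k} (f : Diagram k σ τ) (g : Diagram k τ ρ) (h : Diagram k ρ υ) :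
      Eqv ((f.comp g).comp h) (f.comp (g.comp h))
  | tensor_id (σ τ : Word k) : Eqv ((Diagram.id σ).tensor (Diagram.id τ)) (Diagram.id (σ ++ τ))
  | interchange {σ τ ρ σ' τ' ρ' : Word k} (f : Diagram k σ τ) (g : Diagram k τ ρ)
      (f' : Diagram k σ' τ') (g' : Diagram k τ' ρ') :
      Eqv ((f.tensor f').comp (g.tensor g')) ((f.comp g).tensor (f'.comp g'))
  | nil_tensor {σ τ : Word k} (f : Diagram k σ τ) : Eqv ((Diagram.id []).tensor f) f
  | tensor_nil {σ τ : Word k} (f : Diagram k σ τ) : Eqv (f.tensor (Diagram.id [])) f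
  | tensor_assoc {σ τ σ' τ' σ'' τ'' : Word k} (f : Diagram k σ τ) (g : Diagram k σ' τ')
      (h : Diagram k σ'' τ'') : Eqv ((f.tensor g).tensor h) (f.tensor (g.tensor h))
  | mul_unit (a : Fin (k + 1)) :
      Eqv (((Diagram.id [a]).tensor (Diagram.u a)).comp (Diagram.m a)) (Diagram.id [a])
  | unit_mul (a : Fin (k + 1)) :
      Eqv (((Diagram.u a).tensor (Diagram.id [a])).comp (Diagram.m a)) (Diagram.id [a])
  | twist_unit (c d : Fin (k + 1)) (h : d < c) :
      Eqv (((Diagram.id [c]).tensor (Diagram.u d)).comp (Diagram.t c d h)) ((Diagram.u d).tensor (Diagram.id [c]))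
  | unit_twist (c d : Fin (k + 1)) (h : d < c) :
      Eqv (((Diagram.u c).tensor (Diagram.id [d])).comp (Diagram.t c d h)) ((Diagram.id [d]).tensor (Diagram.u c))

theorem Eqv.dom_cod {k : ℕ} {σ τ σ' τ' : Word k} {f : Diagram k σ τ} {g : Diagram k σ' τ'}
    (h : Eqv f g) : σ = σ' ∧ τ = τ' := by
  induction h <;> simp_all

/-- A formal expression together with its domain and codomain. -/
structure Arrow (k : ℕ) where
  dom : Word k
  cod : Word k
  term : Diagram k dom cod

instance arrowSetoid (k : ℕ) : Setoid (Arrow k) where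
  r f g := Eqv f.term g.term
  iseqv := ⟨fun f => .refl f.term, fun h => h.symm, fun h h' => h.trans h'⟩

/-- The set of all morphisms of `B_k`. -/
def Mor (k : ℕ) : Type := Quotient (arrowSetoid k)

namespace Mor

variable {k : ℕ}

def mk {σ τ : Word k} (f : Diagram k σ τ) : Mor k := Quotient.mk _ ⟨σ, τ, f⟩

def dom (f : Mor k) : Word k := Quotient.lift Arrow.dom (fun _ _ h => (Eqv.dom_cod h).1) f

def cod (f : Mor k) : Word k := Quotient.lift Arrow.cod (fun _ _ h => (Eqv.dom_cod h).2) f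

/-- The identity of the word `σ`. -/
def id (σ : Word k) : Mor k := mk (Diagram.id σ)

/-- The generator `u^a`. -/
def u (a : Fin (k + 1)) : Mor k := mk (Diagram.u a)

/-- The generator `m^a`. -/
def m (a : Fin (k + 1)) : Mor k := mk (Diagram.m a)

/-- The generator `t^{a,b}`, `b < a` (and an irrelevant value otherwise). -/
def t (a b : Fin (k + 1)) : Mor k := if h : b < a then mk (Diagram.t a b h) else id [a, b]

/-- The monoidal product `⊔` of morphisms. -/
def tensor (f g : Mor k) : Mor k :=
  Quotient.map₂ (fun f g : Arrow k => (⟨_, _, f.term.tensor g.term⟩ : Arrow k))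
    (fun _ _ h _ _ h' => Eqv.tensor_congr h h') f g

/-- Composition of arrows: first `f`, then `g`. It is only meaningful if the codomain of `f` is the
domain of `g`; the value is irrelevant otherwise. -/
def _root_.TwistOperad.Arrow.comp (f g : Arrow k) : Arrow k :=
  if h : f.cod = g.dom then ⟨f.dom, g.cod, (h ▸ f.term).comp g.term⟩ else f

theorem _root_.TwistOperad.Arrow.comp_congr (f f' : Arrow k) (hf : f ≈ f') (g g' : Arrow k)
    (hg : g ≈ g') : f.comp g ≈ f'.comp g' := by
  obtain ⟨a, b, f⟩ := f
  obtain ⟨a', b', f'⟩ := f'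
  obtain ⟨c, d, g⟩ := g
  obtain ⟨c', d', g'⟩ := g'
  obtain ⟨h1, h2⟩ := Eqv.dom_cod hf
  obtain ⟨h3, h4⟩ := Eqv.dom_cod hg
  dsimp at h1 h2 h3 h4
  subst h1 h2 h3 h4
  by_cases h : b = c
  · subst h
    simp only [Arrow.comp, dif_pos]
    exact Eqv.comp_congr hf hg
  · simpa only [Arrow.comp, dif_neg h] using hf

/-- Composition of morphisms: first `f`, then `g`. It is only meaningful if the codomain of `f` is
the domain of `g`; the value is irrelevant otherwise. -/
def comp (f g : Mor k) : Mor k :=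
  Quotient.map₂ Arrow.comp Arrow.comp_congr f g

theorem exists_rep (f : Mor k) : ∃ (σ τ : Word k) (x : Diagram k σ τ), f = mk x := by
  obtain ⟨⟨σ, τ, x⟩, rfl⟩ := Quotient.exists_rep f
  exact ⟨σ, τ, x, rfl⟩

theorem exists_rep' (f : Mor k) : ∃ x : Diagram k f.dom f.cod, f = mk x := by
  obtain ⟨σ, τ, x, rfl⟩ := f.exists_rep
  exact ⟨x, rfl⟩

theorem mk_eq_mk {σ τ σ' τ' : Word k} {f : Diagram k σ τ} {g : Diagram k σ' τ'} (h : Eqv f g) :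
    mk f = mk g :=
  Quotient.sound h

@[simp] theorem dom_mk {σ τ : Word k} (f : Diagram k σ τ) : (mk f).dom = σ := rfl
@[simp] theorem cod_mk {σ τ : Word k} (f : Diagram k σ τ) : (mk f).cod = τ := rfl
@[simp] theorem dom_id (σ : Word k) : (id σ).dom = σ := rfl
@[simp] theorem cod_id (σ : Word k) : (id σ).cod = σ := rfl
@[simp] theorem dom_u (a : Fin (k + 1)) : (u a).dom = [] := rfl
@[simp] theorem cod_u (a : Fin (k + 1)) : (u a).cod = [a] := rfl
@[simp] theorem dom_m (a : Fin (k + 1)) : (m a).dom = [a, a] := rfl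
@[simp] theorem cod_m (a : Fin (k + 1)) : (m a).cod = [a] := rfl
@[simp] theorem dom_t (a b : Fin (k + 1)) : (t a b).dom = [a, b] := by
  unfold t; split_ifs <;> rfl

theorem cod_t {a b : Fin (k + 1)} (h : b < a) : (t a b).cod = [b, a] := by
  rw [t, dif_pos h]; rfl

theorem t_eq {a b : Fin (k + 1)} (h : b < a) : t a b = mk (Diagram.t a b h) := dif_pos h

theorem comp_mk {σ τ ρ : Word k} (f : Diagram k σ τ) (g : Diagram k τ ρ) :
    comp (mk f) (mk g) = mk (f.comp g) := by
  show Quotient.mk _ (Arrow.comp _ _) = Quotient.mk _ _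
  simp [Arrow.comp]

theorem tensor_mk {σ τ σ' τ' : Word k} (f : Diagram k σ τ) (g : Diagram k σ' τ') :
    tensor (mk f) (mk g) = mk (f.tensor g) := rfl

/-- The morphisms of `B_k` form a monoid under `⊔`. -/
instance : Monoid (Mor k) where
  mul := tensor
  one := id []
  mul_assoc f g h := by
    obtain ⟨_, _, f, rfl⟩ := f.exists_rep
    obtain ⟨_, _, g, rfl⟩ := g.exists_rep
    obtain ⟨_, _, h, rfl⟩ := h.exists_rep
    exact mk_eq_mk (.tensor_assoc f g h)
  one_mul f := by
    obtain ⟨_, _, f, rfl⟩ := f.exists_rep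
    exact mk_eq_mk (.nil_tensor f)
  mul_one f := by
    obtain ⟨_, _, f, rfl⟩ := f.exists_rep
    exact mk_eq_mk (.tensor_nil f)

theorem mul_mk {σ τ σ' τ' : Word k} (f : Diagram k σ τ) (g : Diagram k σ' τ') :
    mk f * mk g = mk (f.tensor g) := rfl

theorem one_def : (1 : Mor k) = id [] := rfl

@[simp] theorem id_nil : (id [] : Mor k) = 1 := rfl
@[simp] theorem dom_one : (1 : Mor k).dom = [] := rfl
@[simp] theorem cod_one : (1 : Mor k).cod = [] := rfl

@[simp] theorem dom_mul (f g : Mor k) : (f * g).dom = f.dom ++ g.dom := by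
  obtain ⟨_, _, f, rfl⟩ := f.exists_rep
  obtain ⟨_, _, g, rfl⟩ := g.exists_rep
  rfl

@[simp] theorem cod_mul (f g : Mor k) : (f * g).cod = f.cod ++ g.cod := by
  obtain ⟨_, _, f, rfl⟩ := f.exists_rep
  obtain ⟨_, _, g, rfl⟩ := g.exists_rep
  rfl

theorem id_mul_id (σ τ : Word k) : id σ * id τ = id (σ ++ τ) := mk_eq_mk (.tensor_id σ τ)

@[simp] theorem dom_comp (f g : Mor k) : (f.comp g).dom = f.dom := by
  obtain ⟨⟨_, _, f⟩, rfl⟩ := Quotient.exists_rep f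
  obtain ⟨⟨_, _, g⟩, rfl⟩ := Quotient.exists_rep g
  show (Arrow.comp _ _).dom = _
  unfold Arrow.comp
  split_ifs <;> rfl

theorem cod_comp {f g : Mor k} (h : f.cod = g.dom) : (f.comp g).cod = g.cod := by
  obtain ⟨_, _, f, rfl⟩ := f.exists_rep
  obtain ⟨_, _, g, rfl⟩ := g.exists_rep
  dsimp at h
  subst h
  rw [comp_mk]; rfl

theorem id_comp {σ : Word k} {f : Mor k} (h : f.dom = σ) : (id σ).comp f = f := by
  obtain ⟨_, _, f, rfl⟩ := f.exists_rep
  dsimp at h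
  subst h
  rw [id, comp_mk]
  exact mk_eq_mk (.id_comp f)

theorem comp_id {σ : Word k} {f : Mor k} (h : f.cod = σ) : f.comp (id σ) = f := by
  obtain ⟨_, _, f, rfl⟩ := f.exists_rep
  dsimp at h
  subst h
  rw [id, comp_mk]
  exact mk_eq_mk (.comp_id f)

theorem assoc {f g h : Mor k} (h₁ : f.cod = g.dom) (h₂ : g.cod = h.dom) :
    (f.comp g).comp h = f.comp (g.comp h) := by
  obtain ⟨_, _, f, rfl⟩ := f.exists_rep
  obtain ⟨_, _, g, rfl⟩ := g.exists_rep
  obtain ⟨_, _, h, rfl⟩ := h.exists_rep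
  dsimp at h₁ h₂
  subst h₁ h₂
  simp only [comp_mk]
  exact mk_eq_mk (.assoc f g h)

theorem interchange {f g f' g' : Mor k} (h : f.cod = g.dom) (h' : f'.cod = g'.dom) :
    (f * f').comp (g * g') = f.comp g * f'.comp g' := by
  obtain ⟨_, _, f, rfl⟩ := f.exists_rep
  obtain ⟨_, _, g, rfl⟩ := g.exists_rep
  obtain ⟨_, _, f', rfl⟩ := f'.exists_rep
  obtain ⟨_, _, g', rfl⟩ := g'.exists_rep
  dsimp at h h'
  subst h h'
  simp only [comp_mk, mul_mk]
  exact mk_eq_mk (.interchange f g f' g')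

theorem mul_unit (a : Fin (k + 1)) : (id [a] * u a).comp (m a) = id [a] :=
  (comp_mk _ _).trans (mk_eq_mk (.mul_unit a))

theorem unit_mul (a : Fin (k + 1)) : (u a * id [a]).comp (m a) = id [a] :=
  (comp_mk _ _).trans (mk_eq_mk (.unit_mul a))

theorem twist_unit {c d : Fin (k + 1)} (h : d < c) : (id [c] * u d).comp (t c d) = u d * id [c] := by
  rw [t_eq h]
  exact (comp_mk _ _).trans (mk_eq_mk (.twist_unit c d h))

theorem unit_twist {c d : Fin (k + 1)} (h : d < c) : (u c * id [d]).comp (t c d) = id [d] * u c := by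
  rw [t_eq h]
  exact (comp_mk _ _).trans (mk_eq_mk (.unit_twist c d h))

end Mor
namespace Mor

variable {k : ℕ}

theorem comp_mul_id {f g : Mor k} (h : f.cod = g.dom) (σ : Word k) :
    f.comp g * id σ = (f * id σ).comp (g * id σ) := by
  rw [interchange h (by simp), id_comp (by simp)]

theorem id_mul_comp {f g : Mor k} (h : f.cod = g.dom) (σ : Word k) :
    id σ * f.comp g = (id σ * f).comp (id σ * g) := by
  rw [interchange (by simp) h, id_comp (by simp)]

theorem mul_eq_comp (f g : Mor k) : f * g = (f * id g.dom).comp (id f.cod * g) := by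
  rw [interchange (by simp) (by simp), comp_id rfl, id_comp rfl]

theorem mul_eq_comp' (f g : Mor k) : f * g = (id f.dom * g).comp (f * id g.cod) := by
  rw [interchange (by simp) (by simp), comp_id rfl, id_comp rfl]

@[simp] theorem id_comp_id (σ : Word k) : (id σ).comp (id σ) = id σ := id_comp rfl

@[simp] theorem one_comp_one : (1 : Mor k).comp 1 = 1 := id_comp rfl

theorem exchange {f g : Mor k} {σ τ σ' τ' : Word k} (h₁ : f.dom = σ) (h₂ : f.cod = τ)
    (h₃ : g.dom = σ') (h₄ : g.cod = τ') :
    (f * id σ').comp (id τ * g) = (id σ * g).comp (f * id τ') := by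
  subst h₁ h₂ h₃ h₄
  rw [← mul_eq_comp, ← mul_eq_comp']

/-- `u^σ = u^{s_1} ⊔ ⋯ ⊔ u^{s_n} : () → σ` for a word `σ = (s_1, …, s_n)`. -/
def units : Word k → Mor k
  | [] => id []
  | a :: σ => u a * units σ

/-- The morphism `(c) ⊔ σ → σ ⊔ (c)` which moves the strand `c` across all the strands of `σ` (all
the symbols of `σ` are smaller than `c`). -/
def cross₁ (c : Fin (k + 1)) : Word k → Mor k
  | [] => id [c]
  | b :: σ => (t c b * id σ).comp (id [b] * cross₁ c σ)

/-- The morphism `τ ⊔ σ → σ ⊔ τ` which moves all the strands of `τ` across all the strands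
of `σ` (every symbol of `σ` is smaller than every symbol of `τ`). -/
def cross : Word k → Word k → Mor k
  | [], σ => id σ
  | c :: τ, σ => (id [c] * cross τ σ).comp (cross₁ c σ * id τ)

/-- The morphism `σ ⊔ σ → σ`, for a strictly increasing word `σ`, which crosses the strands and
then joins those with equal labels. -/
def join : Word k → Mor k
  | [] => id []
  | a :: σ => (id [a] * cross σ [a] * id σ).comp (m a * join σ)

@[simp] theorem dom_units (σ : Word k) : (units σ).dom = [] := by
  induction σ with
  | nil => rfl
  | cons a σ ih => simp [units, ih]

@[simp] theorem cod_units (σ : Word k) : (units σ).cod = σ := by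
  induction σ with
  | nil => rfl
  | cons a σ ih => simp [units, ih]

@[simp] theorem dom_cross₁ (c : Fin (k + 1)) (σ : Word k) : (cross₁ c σ).dom = c :: σ := by
  cases σ <;> simp [cross₁]

theorem cod_cross₁ {c : Fin (k + 1)} {σ : Word k} (h : ∀ b ∈ σ, b < c) :
    (cross₁ c σ).cod = σ ++ [c] := by
  induction σ with
  | nil => rfl
  | cons b σ ih =>
    have hb := h b (by simp)
    rw [cross₁, cod_comp (by simp [cod_t hb])]
    simp [ih fun x hx => h x (by simp [hx])]

@[simp] theorem dom_cross (τ σ : Word k) : (cross τ σ).dom = τ ++ σ := by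
  induction τ with
  | nil => rfl
  | cons c τ ih => simp [cross, ih]

theorem cod_cross {τ σ : Word k} (h : ∀ c ∈ τ, ∀ b ∈ σ, b < c) :
    (cross τ σ).cod = σ ++ τ := by
  induction τ with
  | nil => simp [cross]
  | cons c τ ih =>
    have := ih fun x hx => h x (by simp [hx])
    rw [cross, cod_comp (by simp [this])]
    simp [cod_cross₁ (h c (by simp))]

@[simp] theorem dom_join (σ : Word k) : (join σ).dom = σ ++ σ := by
  cases σ <;> simp [join]

theorem cod_join {σ : Word k} (h : σ.Pairwise (· < ·)) : (join σ).cod = σ := by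
  induction σ with
  | nil => rfl
  | cons a σ ih =>
    obtain ⟨h₁, h₂⟩ := List.pairwise_cons.1 h
    rw [join, cod_comp (by simp [cod_cross (τ := σ) (σ := [a]) (by simpa using h₁)])]
    simp [ih h₂]

theorem units_append (σ ρ : Word k) : units (σ ++ ρ) = units σ * units ρ := by
  induction σ with
  | nil => simp [units]
  | cons a σ ih => simp [units, ih, mul_assoc]

theorem cross₁_append {c : Fin (k + 1)} {σ ρ : Word k} (h : ∀ b ∈ σ, b < c) :
    cross₁ c (σ ++ ρ) = (cross₁ c σ * id ρ).comp (id σ * cross₁ c ρ) := by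
  induction σ with
  | nil => simp [cross₁, id_mul_id, id_comp]
  | cons b σ ih =>
    have hb := h b (by simp)
    have hσ : ∀ x ∈ σ, x < c := fun x hx => h x (by simp [hx])
    have e : id (b :: σ) = id [b] * id σ := (id_mul_id [b] σ).symm
    rw [List.cons_append, cross₁, ih hσ, cross₁,
      id_mul_comp (by simp [cod_cross₁ hσ]), comp_mul_id (by simp [cod_t hb]),
      assoc (by simp [cod_t hb]) (by simp [cod_cross₁ hσ]), e]
    simp only [mul_assoc]
    rw [id_mul_id]

theorem cross_nil (τ : Word k) : cross τ [] = id τ := by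
  induction τ with
  | nil => rfl
  | cons c τ ih => simp [cross, ih, cross₁, id_mul_id]

theorem cross_singleton (c : Fin (k + 1)) (σ : Word k) : cross [c] σ = cross₁ c σ := by
  simp [cross, id_mul_id, id_comp]

theorem cross₁_singleton {c b : Fin (k + 1)} (h : b < c) : cross₁ c [b] = t c b := by
  simp [cross₁, id_mul_id, comp_id, cod_t h]

theorem cross_append_right {τ σ ρ : Word k} (h : ∀ c ∈ τ, ∀ b ∈ σ ++ ρ, b < c) :
    cross τ (σ ++ ρ) = (cross τ σ * id ρ).comp (id σ * cross τ ρ) := by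
  induction τ with
  | nil => simp [cross, id_mul_id]
  | cons c τ ih =>
    have h₀ : ∀ x ∈ τ, ∀ b ∈ σ ++ ρ, b < x := fun x hx => h x (by simp [hx])
    have h₁ : ∀ b ∈ σ, b < c := fun b hb => h c (by simp) b (by simp [hb])
    have h₂ : ∀ b ∈ ρ, b < c := fun b hb => h c (by simp) b (by simp [hb])
    have h₃ : (cross τ σ).cod = σ ++ τ := cod_cross fun x hx b hb => h₀ x hx b (by simp [hb])
    have h₄ : (cross τ ρ).cod = ρ ++ τ := cod_cross fun x hx b hb => h₀ x hx b (by simp [hb])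
    have h₅ := cod_cross₁ h₁
    have h₆ := cod_cross₁ h₂
    have E : (id (c :: σ) * cross τ ρ).comp (cross₁ c σ * id (ρ ++ τ)) =
        (cross₁ c σ * id (τ ++ ρ)).comp (id (σ ++ [c]) * cross τ ρ) :=
      (exchange (by simp) h₅ (by simp) h₄).symm
    rw [cross, ih h₀, cross₁_append h₁, id_mul_comp (by simp [h₃]), comp_mul_id (by simp [h₅]),
      cross, cross, comp_mul_id (by simp [h₃]), id_mul_comp (by simp [h₄])]
    simp only [← mul_assoc, id_mul_id, List.cons_append, List.nil_append]
    simp only [mul_assoc, id_mul_id, List.cons_append, List.nil_append]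
    rw [assoc (by simp [h₃]) (by simp [h₄, cod_comp, h₅]),
      ← assoc (f := id (c :: σ) * cross τ ρ) (by simp [h₄]) (by simp [h₅]), E,
      assoc (by simp [h₅]) (by simp [h₄]), ← assoc (by simp [h₃]) (by simp [h₅, cod_comp])]

theorem cross_append_left {τ υ σ : Word k} (h : ∀ c ∈ τ ++ υ, ∀ b ∈ σ, b < c) :
    cross (τ ++ υ) σ = (id τ * cross υ σ).comp (cross τ σ * id υ) := by
  have hυ : (cross υ σ).cod = σ ++ υ := cod_cross fun x hx => h x (by simp [hx])
  induction τ with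
  | nil => simp [cross, id_mul_id, comp_id, hυ]
  | cons c τ ih =>
    have h₀ : ∀ c ∈ τ ++ υ, ∀ b ∈ σ, b < c := fun x hx => h x (by
      simp only [List.mem_append, List.mem_cons] at hx ⊢; tauto)
    have h₁ : (cross₁ c σ).cod = _ := cod_cross₁ (h c (by simp))
    have h₂ : (cross τ σ).cod = σ ++ τ := cod_cross fun x hx => h₀ x (by simp [hx])
    rw [List.cons_append, cross, ih h₀, id_mul_comp (by simp [hυ]), cross,
      comp_mul_id (by simp [h₂])]
    simp only [← mul_assoc, id_mul_id, List.cons_append, List.nil_append]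
    simp only [mul_assoc, id_mul_id, List.cons_append, List.nil_append]
    rw [assoc (by simp [hυ]) (by simp [h₂])]

theorem join_singleton (a : Fin (k + 1)) : join [a] = m a := by
  simp [join, cross, id_mul_id, id_comp (f := m a) (σ := [a, a]) rfl]

theorem join_append {σ ρ : Word k} (h : (σ ++ ρ).Pairwise (· < ·)) :
    join (σ ++ ρ) = (id σ * cross ρ σ * id ρ).comp (join σ * join ρ) := by
  induction σ with
  | nil => simp [join, cross_nil, id_mul_id, id_comp]
  | cons a σ ih =>
    rw [List.cons_append] at h
    obtain ⟨h₁, h₂⟩ := List.pairwise_cons.1 h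
    have hρσ : ∀ c ∈ ρ, ∀ b ∈ σ, b < c := fun c hc b hb => (List.pairwise_append.1 h₂).2.2 b hb c hc
    have hρa : ∀ c ∈ ρ, ∀ b ∈ [a], b < c := fun c hc b hb => by
      obtain rfl := List.mem_singleton.1 hb
      exact h₁ c (by simp [hc])
    have hσa : ∀ c ∈ σ, ∀ b ∈ [a], b < c := fun c hc b hb => by
      obtain rfl := List.mem_singleton.1 hb
      exact h₁ c (by simp [hc])
    have hσρa : ∀ c ∈ σ ++ ρ, ∀ b ∈ [a], b < c := fun c hc b hb => by
      obtain rfl := List.mem_singleton.1 hb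
      exact h₁ c hc
    have e₁ : cross ρ (a :: σ) = (cross ρ [a] * id σ).comp (id [a] * cross ρ σ) :=
      cross_append_right (σ := [a]) (ρ := σ) (by
        intro c hc b hb
        rcases List.mem_append.1 hb with hb | hb
        exacts [hρa c hc b hb, hρσ c hc b hb])
    have c₁ := cod_cross hρσ
    have c₂ := cod_cross hρa
    have c₃ := cod_cross hσa
    have c₄ : (join σ).cod = σ := cod_join (List.pairwise_append.1 h₂).1
    have c₅ : (join ρ).cod = ρ := cod_join (List.pairwise_append.1 h₂).2.1
    have hm : m a * (id σ * cross ρ σ * id ρ).comp (join σ * join ρ) =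
        (id ([a, a] ++ σ) * cross ρ σ * id ρ).comp (m a * join σ * join ρ) := by
      have := interchange (f := id [a, a]) (g := m a) (f' := id σ * cross ρ σ * id ρ)
        (g' := join σ * join ρ) rfl (by simp [c₁])
      rw [id_comp (σ := [a, a]) (f := m a) rfl] at this
      rw [← this, ← id_mul_id]
      simp only [mul_assoc]
    have hj : (id [a] * cross σ [a] * id σ).comp (m a * join σ) * join ρ =
        (id [a] * cross σ [a] * id (σ ++ (ρ ++ ρ))).comp (m a * join σ * join ρ) := by
      have := interchange (f := id [a] * cross σ [a] * id σ) (g := m a * join σ)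
        (f' := id (ρ ++ ρ)) (g' := join ρ) (by simp [c₃]) (by simp)
      rw [id_comp (by simp)] at this
      rw [← this, ← id_mul_id σ (ρ ++ ρ)]
      simp only [mul_assoc]
    have E : (id [a] * cross σ [a] * id (ρ ++ (σ ++ ρ))).comp
          (id ([a, a] ++ σ) * cross ρ σ * id ρ) =
        (id ([a] ++ (σ ++ [a])) * cross ρ σ * id ρ).comp
          (id [a] * cross σ [a] * id (σ ++ (ρ ++ ρ))) := by
      have := exchange (f := cross σ [a]) (g := cross ρ σ) (dom_cross _ _) c₃ (dom_cross _ _) c₁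
      have := congrArg (fun f => id [a] * f * id ρ) this
      rw [id_mul_comp (by simp [c₃]), id_mul_comp (by simp [c₁]), comp_mul_id (by simp [c₃]),
        comp_mul_id (by simp [c₁])] at this
      simp only [← mul_assoc, id_mul_id] at this
      simp only [mul_assoc, id_mul_id] at this
      simpa only [mul_assoc, List.append_assoc, List.cons_append, List.nil_append] using this
    have hl : id [a] * (id σ * cross ρ [a]).comp (cross σ [a] * id ρ) * id (σ ++ ρ) =
        (id ([a] ++ σ) * cross ρ [a] * id (σ ++ ρ)).comp
          (id [a] * cross σ [a] * id (ρ ++ (σ ++ ρ))) := by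
      rw [id_mul_comp (by simp [c₂]), comp_mul_id (by simp [c₂])]
      simp only [← mul_assoc, id_mul_id]
      simp only [mul_assoc, id_mul_id]
    have hr : id ([a] ++ σ) * (cross ρ [a] * id σ).comp (id [a] * cross ρ σ) * id ρ =
        (id ([a] ++ σ) * cross ρ [a] * id (σ ++ ρ)).comp
          (id ([a] ++ (σ ++ [a])) * cross ρ σ * id ρ) := by
      rw [id_mul_comp (by simp [c₂]), comp_mul_id (by simp [c₂])]
      simp only [← mul_assoc, id_mul_id]
      simp only [mul_assoc, id_mul_id]
      simp only [List.append_assoc]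
    rw [List.cons_append, join, ih h₂, cross_append_left hσρa, hm, join, hl, hj, e₁]
    rw [show a :: σ = [a] ++ σ from rfl, hr]
    rw [assoc (by simp [c₃, c₂]) (by simp [c₃]), assoc (by simp [c₁, c₂]) (by simp [c₃, c₁]),
      ← assoc (f := id [a] * cross σ [a] * id (ρ ++ (σ ++ ρ))) (by simp [c₃]) (by simp [c₁]), E, assoc (by simp [c₁]) (by simp [c₃])]


theorem units_cross₁ {c : Fin (k + 1)} {σ : Word k} (h : ∀ b ∈ σ, b < c) :
    (id [c] * units σ).comp (cross₁ c σ) = units σ * id [c] := by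
  induction σ with
  | nil => simp [units, cross₁]
  | cons b σ ih =>
    have hb := h b (by simp)
    have hσ : ∀ x ∈ σ, x < c := fun x hx => h x (by simp [hx])
    rw [units, cross₁, ← mul_assoc, ← assoc (by simp) (by simp [cod_t hb]),
      interchange (by simp) (by simp), twist_unit hb, comp_id (by simp), mul_assoc,
      interchange (by simp) (by simp), ih hσ, comp_id (by simp), mul_assoc]

theorem unit_cross₁ {c : Fin (k + 1)} {σ : Word k} (h : ∀ b ∈ σ, b < c) :
    (u c * id σ).comp (cross₁ c σ) = id σ * u c := by
  induction σ with
  | nil => simp [cross₁, comp_id (f := u c) (σ := [c]) rfl]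
  | cons b σ ih =>
    have hb := h b (by simp)
    have hσ : ∀ x ∈ σ, x < c := fun x hx => h x (by simp [hx])
    rw [cross₁, show id (b :: σ) = id [b] * id σ from (id_mul_id [b] σ).symm, ← mul_assoc,
      ← assoc (by simp) (by simp [cod_t hb]),
      interchange (by simp) (by simp), unit_twist hb, id_comp_id, mul_assoc,
      interchange (by simp) (by simp), ih hσ, id_comp_id, mul_assoc]

theorem units_cross {τ σ : Word k} (h : ∀ c ∈ τ, ∀ b ∈ σ, b < c) :
    (id τ * units σ).comp (cross τ σ) = units σ * id τ := by
  induction τ with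
  | nil => simp [cross, comp_id]
  | cons c τ ih =>
    have h₀ : ∀ x ∈ τ, ∀ b ∈ σ, b < x := fun x hx => h x (by simp [hx])
    rw [cross, show id (c :: τ) = id [c] * id τ from (id_mul_id [c] τ).symm, mul_assoc,
      ← assoc (by simp) (by simp [cod_cross h₀]), interchange (by simp) (by simp), ih h₀,
      id_comp_id, ← mul_assoc, interchange (by simp) (by simp), units_cross₁ (h c (by simp)),
      id_comp_id, mul_assoc]

theorem cross_units {τ σ : Word k} (h : ∀ c ∈ τ, ∀ b ∈ σ, b < c) :
    (units τ * id σ).comp (cross τ σ) = id σ * units τ := by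
  induction τ with
  | nil => simp [cross, units]
  | cons c τ ih =>
    have h₀ : ∀ x ∈ τ, ∀ b ∈ σ, b < x := fun x hx => h x (by simp [hx])
    rw [cross, units, mul_assoc,
      ← assoc (by simp) (by simp [cod_cross h₀]), interchange (by simp) (by simp), ih h₀,
      comp_id (by simp), ← mul_assoc, interchange (by simp) (by simp), unit_cross₁ (h c (by simp)),
      comp_id (by simp), mul_assoc]

theorem units_join {σ : Word k} (h : σ.Pairwise (· < ·)) :
    (id σ * units σ).comp (join σ) = id σ := by
  induction σ with
  | nil => simp [units, join]
  | cons a σ ih =>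
    obtain ⟨h₁, h₂⟩ := List.pairwise_cons.1 h
    have h₃ : ∀ c ∈ σ, ∀ b ∈ [a], b < c := by simpa using h₁
    have e := units_cross h₃
    simp only [units, id_nil, mul_one] at e
    rw [join, show id (a :: σ) = id [a] * id σ from (id_mul_id [a] σ).symm, units,
      show id [a] * id σ * (u a * units σ) = id [a] * (id σ * u a) * units σ by
        simp only [mul_assoc],
      ← assoc (by simp) (by simp [cod_cross h₃]), interchange (by simp) (by simp),
      interchange (f := id [a]) (g := id [a]) (by simp) (by simp), e, id_comp_id,
      comp_id (by simp),
      show id [a] * (u a * id σ) * units σ = (id [a] * u a) * (id σ * units σ) by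
        simp only [mul_assoc],
      interchange (by simp) (by simp), mul_unit, ih h₂]

theorem join_units {σ : Word k} (h : σ.Pairwise (· < ·)) :
    (units σ * id σ).comp (join σ) = id σ := by
  induction σ with
  | nil => simp [units, join]
  | cons a σ ih =>
    obtain ⟨h₁, h₂⟩ := List.pairwise_cons.1 h
    have h₃ : ∀ c ∈ σ, ∀ b ∈ [a], b < c := by simpa using h₁
    rw [join, show id (a :: σ) = id [a] * id σ from (id_mul_id [a] σ).symm, units,
      show u a * units σ * (id [a] * id σ) = u a * (units σ * id [a]) * id σ by
        simp only [mul_assoc],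
      ← assoc (by simp) (by simp [cod_cross h₃]), interchange (by simp) (by simp),
      interchange (f := u a) (g := id [a]) (by simp) (by simp), cross_units h₃, id_comp_id,
      comp_id (by simp),
      show u a * (id [a] * units σ) * id σ = (u a * id [a]) * (units σ * id σ) by
        simp only [mul_assoc],
      interchange (by simp) (by simp), unit_mul, ih h₂]

end Mor
/-! ### The simplicial operators -/

/-- The fibre of a monotone map over `a`, listed in increasing order. -/
def fiber {l k : ℕ} (θ : Fin (l + 1) →o Fin (k + 1)) (a : Fin (k + 1)) : Word l :=
  (List.finRange (l + 1)).filter fun x => θ x = a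

/-- The action of a monotone map `[l] → [k]` on objects, `B_k → B_l`: every symbol is replaced by
its fibre. -/
def pullWord {l k : ℕ} (θ : Fin (l + 1) →o Fin (k + 1)) (σ : Word k) : Word l :=
  σ.flatMap (fiber θ)

section

variable {l k j : ℕ}

@[simp] theorem mem_fiber {θ : Fin (l + 1) →o Fin (k + 1)} {a : Fin (k + 1)} {x : Fin (l + 1)} :
    x ∈ fiber θ a ↔ θ x = a := by
  simp [fiber]

@[simp] theorem mem_pullWord {θ : Fin (l + 1) →o Fin (k + 1)} {σ : Word k} {x : Fin (l + 1)} :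
    x ∈ pullWord θ σ ↔ θ x ∈ σ := by
  simp [pullWord]

theorem pairwise_fiber (θ : Fin (l + 1) →o Fin (k + 1)) (a : Fin (k + 1)) :
    (fiber θ a).Pairwise (· < ·) :=
  List.Pairwise.filter _ (List.pairwise_lt_finRange _)

@[simp] theorem pullWord_nil (θ : Fin (l + 1) →o Fin (k + 1)) : pullWord θ [] = [] := rfl

@[simp] theorem pullWord_append (θ : Fin (l + 1) →o Fin (k + 1)) (σ τ : Word k) :
    pullWord θ (σ ++ τ) = pullWord θ σ ++ pullWord θ τ := by
  simp [pullWord]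

@[simp] theorem pullWord_cons (θ : Fin (l + 1) →o Fin (k + 1)) (a : Fin (k + 1)) (σ : Word k) :
    pullWord θ (a :: σ) = fiber θ a ++ pullWord θ σ := rfl

theorem lt_of_map_lt (θ : Fin (l + 1) →o Fin (k + 1)) {x y : Fin (l + 1)} (h : θ x < θ y) :
    x < y := by
  by_contra h'
  exact absurd (θ.monotone (not_lt.1 h')) (not_le.2 h)

theorem pairwise_pullWord (θ : Fin (l + 1) →o Fin (k + 1)) {σ : Word k}
    (h : σ.Pairwise (· < ·)) : (pullWord θ σ).Pairwise (· < ·) := by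
  induction σ with
  | nil => simp
  | cons a σ ih =>
    obtain ⟨h₁, h₂⟩ := List.pairwise_cons.1 h
    rw [pullWord_cons, List.pairwise_append]
    refine ⟨pairwise_fiber θ a, ih h₂, fun x hx y hy => lt_of_map_lt θ ?_⟩
    rw [mem_fiber.1 hx]
    exact h₁ _ (mem_pullWord.1 hy)

theorem eq_of_pairwise {σ τ : Word k} (h : σ.Pairwise (· < ·)) (h' : τ.Pairwise (· < ·))
    (H : ∀ x, x ∈ σ ↔ x ∈ τ) : σ = τ := by
  refine List.Perm.eq_of_pairwise (le := (· < ·)) (fun a b _ _ h₁ h₂ => (lt_asymm h₁ h₂).elim) h h'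
    ((List.perm_ext_iff_of_nodup (h.imp ne_of_lt) (h'.imp ne_of_lt)).2 H)

theorem pullWord_finRange (θ : Fin (l + 1) →o Fin (k + 1)) :
    pullWord θ (List.finRange (k + 1)) = List.finRange (l + 1) :=
  eq_of_pairwise (pairwise_pullWord θ (List.pairwise_lt_finRange _)) (List.pairwise_lt_finRange _)
    (by simp)

theorem pullWord_fiber (φ : Fin (j + 1) →o Fin (l + 1)) (θ : Fin (l + 1) →o Fin (k + 1))
    (a : Fin (k + 1)) : pullWord φ (fiber θ a) = fiber (θ.comp φ) a :=
  eq_of_pairwise (pairwise_pullWord φ (pairwise_fiber θ a)) (pairwise_fiber _ a) (by simp)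

theorem pullWord_pullWord (φ : Fin (j + 1) →o Fin (l + 1)) (θ : Fin (l + 1) →o Fin (k + 1))
    (σ : Word k) : pullWord φ (pullWord θ σ) = pullWord (θ.comp φ) σ := by
  induction σ with
  | nil => rfl
  | cons a σ ih => simp [ih, pullWord_fiber]

theorem fiber_id (a : Fin (k + 1)) : fiber OrderHom.id a = [a] :=
  eq_of_pairwise (pairwise_fiber _ a) (by simp) (by simp)

theorem pullWord_id (σ : Word k) : pullWord OrderHom.id σ = σ := by
  induction σ with
  | nil => rfl
  | cons a σ ih => simp [ih, fiber_id]

theorem fiber_lt (θ : Fin (l + 1) →o Fin (k + 1)) {a b : Fin (k + 1)} (h : b < a) :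
    ∀ c ∈ fiber θ a, ∀ d ∈ fiber θ b, d < c := by
  intro c hc d hd
  rw [mem_fiber] at hc hd
  exact lt_of_map_lt θ (by rwa [hc, hd])

theorem pullWord_lt (θ : Fin (l + 1) →o Fin (k + 1)) {τ σ : Word k}
    (h : ∀ c ∈ τ, ∀ b ∈ σ, b < c) : ∀ c ∈ pullWord θ τ, ∀ b ∈ pullWord θ σ, b < c := by
  intro c hc d hd
  exact lt_of_map_lt θ (h _ (mem_pullWord.1 hc) _ (mem_pullWord.1 hd))

/-- The face operator `d_i` deletes the symbol `i`. -/
theorem fiber_face_self (i : Fin (k + 1 + 1)) :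
    fiber (Fin.succAboveOrderEmb i).toOrderHom i = [] :=
  List.eq_nil_iff_forall_not_mem.2 fun x => by simp [Fin.succAbove_ne]

/-- The face operator `d_i` keeps all other symbols, up to the renumbering of
`{0, …, k + 1} ∖ {i}` by `{0, …, k}`. -/
theorem fiber_face (i : Fin (k + 1 + 1)) (b : Fin (k + 1)) :
    fiber (Fin.succAboveOrderEmb i).toOrderHom (i.succAbove b) = [b] :=
  eq_of_pairwise (pairwise_fiber _ _) (by simp) (by simp)

/-- The degeneracy operator `s_i` replaces the symbol `i` by `i, i + 1`. -/
theorem fiber_degeneracy_self (i : Fin (k + 1)) :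
    fiber i.predAboveOrderHom i = [i.castSucc, i.succ] := by
  refine eq_of_pairwise (pairwise_fiber _ _) (by simp) fun x => ?_
  simp only [mem_fiber, Fin.predAboveOrderHom_coe, Fin.predAbove, Fin.ext_iff, List.mem_cons,
    List.not_mem_nil, or_false, Fin.val_castSucc, Fin.val_succ]
  split_ifs with h <;> simp [Fin.lt_def] at h ⊢ <;> omega

/-- The degeneracy operator `s_i` keeps all other symbols, up to renumbering. -/
theorem fiber_degeneracy (i : Fin (k + 1)) {b : Fin (k + 1)} (hb : b ≠ i) :
    fiber i.predAboveOrderHom b = [if b < i then b.castSucc else b.succ] := by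
  refine eq_of_pairwise (pairwise_fiber _ _) (by simp) fun x => ?_
  rw [Ne, Fin.ext_iff] at hb
  simp only [mem_fiber, Fin.predAboveOrderHom_coe, Fin.predAbove, Fin.ext_iff, List.mem_cons,
    List.not_mem_nil, or_false]
  split_ifs with h h' h' <;>
    simp only [Fin.lt_def, Fin.val_castSucc, Fin.val_succ, Fin.val_pred, Fin.coe_castPred] at h h' ⊢ <;>
    omega

/-- The action of a monotone map `θ : [l] → [k]` on formal expressions. It is determined by
monoidality, functoriality and its values on the generators: `u^a` is sent to `u^x ⊔ ⋯ ⊔ u^y` if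
`x < ⋯ < y` is the fibre over `a`, `m^a` to the diagram which joins two copies of the fibre,
and `t^{a,b}` to the crossing of the fibre of `a` with the fibre of `b`. -/
def Diagram.pull (θ : Fin (l + 1) →o Fin (k + 1)) {σ τ : Word k} : Diagram k σ τ → Mor l
  | .id σ => Mor.id (pullWord θ σ)
  | .u a => Mor.units (fiber θ a)
  | .m a => Mor.join (fiber θ a)
  | .t a b _ => Mor.cross (fiber θ a) (fiber θ b)
  | .comp f g => (f.pull θ).comp (g.pull θ)
  | .tensor f g => f.pull θ * g.pull θ

theorem Diagram.dom_cod_pull (θ : Fin (l + 1) →o Fin (k + 1)) {σ τ : Word k} (f : Diagram k σ τ) :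
    (f.pull θ).dom = pullWord θ σ ∧ (f.pull θ).cod = pullWord θ τ := by
  induction f with
  | id σ => exact ⟨rfl, rfl⟩
  | u a => simp [Diagram.pull]
  | m a => simp [Diagram.pull, Mor.cod_join (pairwise_fiber θ a)]
  | t a b h => simp [Diagram.pull, Mor.cod_cross (fiber_lt θ h)]
  | comp f g hf hg => simp [Diagram.pull, Mor.cod_comp, hf, hg]
  | tensor f g hf hg => simp [Diagram.pull, hf, hg]

@[simp] theorem Diagram.dom_pull (θ : Fin (l + 1) →o Fin (k + 1)) {σ τ : Word k}
    (f : Diagram k σ τ) : (f.pull θ).dom = pullWord θ σ := (f.dom_cod_pull θ).1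

@[simp] theorem Diagram.cod_pull (θ : Fin (l + 1) →o Fin (k + 1)) {σ τ : Word k}
    (f : Diagram k σ τ) : (f.pull θ).cod = pullWord θ τ := (f.dom_cod_pull θ).2

theorem Diagram.pull_eq (θ : Fin (l + 1) →o Fin (k + 1)) {σ τ σ' τ' : Word k} {f : Diagram k σ τ}
    {g : Diagram k σ' τ'} (h : Eqv f g) : f.pull θ = g.pull θ := by
  induction h with
  | refl f => rfl
  | symm _ ih => exact ih.symm
  | trans _ _ ih ih' => exact ih.trans ih'
  | comp_congr _ _ ih ih' => rw [Diagram.pull, Diagram.pull, ih, ih']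
  | tensor_congr _ _ ih ih' => rw [Diagram.pull, Diagram.pull, ih, ih']
  | id_comp f => exact Mor.id_comp (by simp)
  | comp_id f => exact Mor.comp_id (by simp)
  | assoc f g h => exact Mor.assoc (by simp) (by simp)
  | tensor_id σ τ => simp [Diagram.pull, Mor.id_mul_id]
  | interchange f g f' g' => exact Mor.interchange (by simp) (by simp)
  | nil_tensor f => exact one_mul _
  | tensor_nil f => exact mul_one _
  | tensor_assoc f g h => exact mul_assoc _ _ _
  | mul_unit a => simpa [Diagram.pull] using Mor.units_join (pairwise_fiber θ a)
  | unit_mul a => simpa [Diagram.pull] using Mor.join_units (pairwise_fiber θ a)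
  | twist_unit c d h => simpa [Diagram.pull] using Mor.units_cross (fiber_lt θ h)
  | unit_twist c d h => simpa [Diagram.pull] using Mor.cross_units (fiber_lt θ h)

/-- The functor `θ^* : B_k → B_l` induced by a monotone map `θ : [l] → [k]`, on morphisms. -/
def Mor.pull (θ : Fin (l + 1) →o Fin (k + 1)) (f : Mor k) : Mor l :=
  Quotient.lift (fun f : Arrow k => f.term.pull θ) (fun _ _ h => Diagram.pull_eq θ h) f

namespace Mor

theorem pull_mk (θ : Fin (l + 1) →o Fin (k + 1)) {σ τ : Word k} (f : Diagram k σ τ) :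
    (mk f).pull θ = f.pull θ := rfl

@[simp] theorem dom_pull (θ : Fin (l + 1) →o Fin (k + 1)) (f : Mor k) :
    (f.pull θ).dom = pullWord θ f.dom := by
  obtain ⟨_, _, f, rfl⟩ := f.exists_rep
  simp [pull_mk]

@[simp] theorem cod_pull (θ : Fin (l + 1) →o Fin (k + 1)) (f : Mor k) :
    (f.pull θ).cod = pullWord θ f.cod := by
  obtain ⟨_, _, f, rfl⟩ := f.exists_rep
  simp [pull_mk]

@[simp] theorem pull_id (θ : Fin (l + 1) →o Fin (k + 1)) (σ : Word k) :
    (id σ).pull θ = id (pullWord θ σ) := rfl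

@[simp] theorem pull_one (θ : Fin (l + 1) →o Fin (k + 1)) : (1 : Mor k).pull θ = 1 := rfl

theorem pull_u (θ : Fin (l + 1) →o Fin (k + 1)) (a : Fin (k + 1)) :
    (u a).pull θ = units (fiber θ a) := rfl

theorem pull_m (θ : Fin (l + 1) →o Fin (k + 1)) (a : Fin (k + 1)) :
    (m a).pull θ = join (fiber θ a) := rfl

theorem pull_t (θ : Fin (l + 1) →o Fin (k + 1)) {a b : Fin (k + 1)} (h : b < a) :
    (t a b).pull θ = cross (fiber θ a) (fiber θ b) := by
  rw [t_eq h]; rfl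

@[simp] theorem pull_mul (θ : Fin (l + 1) →o Fin (k + 1)) (f g : Mor k) :
    (f * g).pull θ = f.pull θ * g.pull θ := by
  obtain ⟨_, _, f, rfl⟩ := f.exists_rep
  obtain ⟨_, _, g, rfl⟩ := g.exists_rep
  rfl

theorem pull_comp (θ : Fin (l + 1) →o Fin (k + 1)) {f g : Mor k} (h : f.cod = g.dom) :
    (f.comp g).pull θ = (f.pull θ).comp (g.pull θ) := by
  obtain ⟨_, _, f, rfl⟩ := f.exists_rep
  obtain ⟨_, _, g, rfl⟩ := g.exists_rep
  dsimp at h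
  subst h
  rw [comp_mk]; rfl

theorem pull_units (θ : Fin (l + 1) →o Fin (k + 1)) (σ : Word k) :
    (units σ).pull θ = units (pullWord θ σ) := by
  induction σ with
  | nil => rfl
  | cons a σ ih => simp [units, ih, units_append, pull_u]

theorem pull_cross₁ (θ : Fin (l + 1) →o Fin (k + 1)) {c : Fin (k + 1)} {σ : Word k}
    (h : ∀ b ∈ σ, b < c) : (cross₁ c σ).pull θ = cross (fiber θ c) (pullWord θ σ) := by
  induction σ with
  | nil => simp [cross₁, cross_nil]
  | cons b σ ih =>
    have hb := h b (by simp)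
    have hσ : ∀ x ∈ σ, x < c := fun x hx => h x (by simp [hx])
    have H : ∀ c' ∈ fiber θ c, ∀ d ∈ fiber θ b ++ pullWord θ σ, d < c' := by
      simpa using pullWord_lt θ (τ := [c]) (σ := b :: σ) (by simpa using h)
    rw [cross₁, pull_comp (f := t c b * id σ) θ (by simp [cod_t hb]), pull_mul, pull_mul, pull_t θ hb, ih hσ,
      pullWord_cons, cross_append_right H]
    simp

theorem pull_cross (θ : Fin (l + 1) →o Fin (k + 1)) {τ σ : Word k}
    (h : ∀ c ∈ τ, ∀ b ∈ σ, b < c) :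
    (cross τ σ).pull θ = cross (pullWord θ τ) (pullWord θ σ) := by
  induction τ with
  | nil => rfl
  | cons c τ ih =>
    have h₀ : ∀ x ∈ τ, ∀ b ∈ σ, b < x := fun x hx => h x (by simp [hx])
    have H : ∀ x ∈ fiber θ c ++ pullWord θ τ, ∀ d ∈ pullWord θ σ, d < x := pullWord_lt θ h
    rw [cross, pull_comp (f := id [c] * cross τ σ) θ (by simp [cod_cross h₀]), pull_mul, pull_mul, ih h₀,
      pull_cross₁ θ (h c (by simp)), pullWord_cons, cross_append_left H]
    simp

theorem pull_join (θ : Fin (l + 1) →o Fin (k + 1)) {σ : Word k} (h : σ.Pairwise (· < ·)) :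
    (join σ).pull θ = join (pullWord θ σ) := by
  induction σ with
  | nil => rfl
  | cons a σ ih =>
    obtain ⟨h₁, h₂⟩ := List.pairwise_cons.1 h
    have h₃ : ∀ c ∈ σ, ∀ b ∈ [a], b < c := by simpa using h₁
    have H : (fiber θ a ++ pullWord θ σ).Pairwise (· < ·) := pairwise_pullWord θ h
    rw [join, pull_comp (f := id [a] * cross σ [a] * id σ) θ (by simp [cod_cross h₃]), pull_mul, pull_mul, pull_mul, ih h₂,
      pull_cross θ h₃, pullWord_cons θ a σ, join_append H, pull_m]
    simp

theorem pull_pull (φ : Fin (j + 1) →o Fin (l + 1)) (θ : Fin (l + 1) →o Fin (k + 1)) (f : Mor k) :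
    (f.pull θ).pull φ = f.pull (θ.comp φ) := by
  obtain ⟨_, _, f, rfl⟩ := f.exists_rep
  simp only [pull_mk]
  induction f with
  | id σ => simp [Diagram.pull, pullWord_pullWord]
  | u a => simp [Diagram.pull, pull_units, pullWord_fiber]
  | m a => simp [Diagram.pull, pull_join φ (pairwise_fiber θ a), pullWord_fiber]
  | t a b h => simp [Diagram.pull, pull_cross φ (fiber_lt θ h), pullWord_fiber]
  | comp f g hf hg => rw [Diagram.pull, pull_comp φ (by simp), hf, hg]; rfl
  | tensor f g hf hg => rw [Diagram.pull, pull_mul, hf, hg]; rfl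

theorem pull_id_eq (f : Mor k) : f.pull OrderHom.id = f := by
  obtain ⟨_, _, f, rfl⟩ := f.exists_rep
  simp only [pull_mk]
  induction f with
  | id σ => simp [Diagram.pull, pullWord_id]; rfl
  | u a => simp [Diagram.pull, fiber_id, units]; rfl
  | m a => simp [Diagram.pull, fiber_id, join_singleton]; rfl
  | t a b h => simp [Diagram.pull, fiber_id, cross_singleton, cross₁_singleton h, t_eq h]
  | comp f g hf hg => rw [Diagram.pull, hf, hg, comp_mk]
  | tensor f g hf hg => rw [Diagram.pull, hf, hg]; rfl

end Mor

end

/-! ### The simplicial sets `TW n` -/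

/-- `Hom_{B_k}(σ, τ)`. -/
def Hom {k : ℕ} (σ τ : Word k) : Type := {f : Mor k // f.dom = σ ∧ f.cod = τ}

namespace Hom

variable {k l : ℕ}

@[ext] theorem ext {σ τ : Word k} {f g : Hom σ τ} (h : f.1 = g.1) : f = g := Subtype.ext h

/-- The identity morphism. -/
def id (σ : Word k) : Hom σ σ := ⟨Mor.id σ, rfl, rfl⟩

/-- Composition: first `f`, then `g`. -/
def comp {σ τ ρ : Word k} (f : Hom σ τ) (g : Hom τ ρ) : Hom σ ρ :=
  ⟨f.1.comp g.1, by
    rw [Mor.dom_comp, Mor.cod_comp (f.2.2.trans g.2.1.symm)]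
    exact ⟨f.2.1, g.2.2⟩⟩

/-- The monoidal product `f ⊔ g`. -/
def tensor {σ τ σ' τ' : Word k} (f : Hom σ τ) (g : Hom σ' τ') : Hom (σ ++ σ') (τ ++ τ') :=
  ⟨f.1 * g.1, by simp [f.2, g.2]⟩

/-- A morphism `σ → τ`, regarded as a morphism `σ' → τ'` between equal words. -/
def cast {σ τ σ' τ' : Word k} (f : Hom σ τ) (h : σ = σ') (h' : τ = τ') : Hom σ' τ' :=
  ⟨f.1, f.2.1.trans h, f.2.2.trans h'⟩

/-- The functor `θ^* : B_k → B_l` induced by a monotone map `θ : [l] → [k]`. -/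
def pull {σ τ : Word k} (θ : Fin (l + 1) →o Fin (k + 1)) (f : Hom σ τ) :
    Hom (pullWord θ σ) (pullWord θ τ) :=
  ⟨f.1.pull θ, by simp [f.2]⟩

end Hom

/-- The small category `B_k`; its objects are the words in `0, …, k`. -/
def B (k : ℕ) : Type := Word k

instance (k : ℕ) : CategoryTheory.SmallCategory (B k) where
  Hom σ τ := Hom (k := k) σ τ
  id σ := Hom.id (k := k) σ
  comp := Hom.comp
  id_comp f := Hom.ext (Mor.id_comp f.2.1)
  comp_id f := Hom.ext (Mor.comp_id f.2.2)
  assoc f g h := Hom.ext (Mor.assoc (f.2.2.trans g.2.1.symm) (g.2.2.trans h.2.1.symm))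

/-- The object `[k]^n = (0 … k 0 … k ⋯ 0 … k)` of `B_k`. -/
def pow (k n : ℕ) : Word k := (List.replicate n (List.finRange (k + 1))).flatten

theorem pow_zero (k : ℕ) : pow k 0 = [] := rfl

theorem pow_succ (k n : ℕ) : pow k (n + 1) = List.finRange (k + 1) ++ pow k n := by
  simp [pow, List.replicate_succ]

theorem pow_one (k : ℕ) : pow k 1 = List.finRange (k + 1) := by
  simp [pow]

theorem pow_add (k n p : ℕ) : pow k (n + p) = pow k n ++ pow k p := by
  rw [pow, List.replicate_add, List.flatten_append]; rfl

theorem pullWord_pow {k l : ℕ} (θ : Fin (l + 1) →o Fin (k + 1)) (n : ℕ) :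
    pullWord θ (pow k n) = pow l n := by
  induction n with
  | zero => rfl
  | succ n ih => rw [pow_succ, pow_succ, pullWord_append, pullWord_finRange, ih]

open CategoryTheory Simplicial Opposite in
/-- The simplicial set `TW(n)`, with `TW(n)_k = Hom_{B_k}([k]^n, [k])`. -/
def TW (n : ℕ) : SSet.{0} where
  obj Δ := Hom (pow Δ.unop.len n) (List.finRange (Δ.unop.len + 1))
  map θ := ↾fun f => (f.pull θ.unop.toOrderHom).cast (pullWord_pow _ n) (pullWord_finRange _)
  map_id Δ := by
    ext f
    exact Mor.pull_id_eq f.1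
  map_comp θ φ := by
    ext f
    exact (Mor.pull_pull φ.unop.toOrderHom θ.unop.toOrderHom f.1).symm
/-- The morphism `y_0 ⊔ ⋯ ⊔ y_{n-1} : [k]^{∑ m_i} → [k]^n`. -/
def tensorAll {k : ℕ} : {n : ℕ} → (m : Fin n → ℕ) →
    (∀ i, Hom (pow k (m i)) (List.finRange (k + 1))) → Hom (pow k (∑ i, m i)) (pow k n)
  | 0, _, _ => (Hom.id []).cast (by simp [pow_zero]) rfl
  | n + 1, m, y =>
    ((y 0).tensor (tensorAll (fun i => m i.succ) fun i => y i.succ)).cast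
      (by rw [Fin.sum_univ_succ, pow_add]) (pow_succ k n).symm

open CategoryTheory Simplicial in
/-- The operadic unit, in each simplicial degree: the identity of `[k]`. -/
def TW.unit (k : ℕ) : (TW 1) _⦋k⦌ := (Hom.id (List.finRange (k + 1))).cast (pow_one k).symm rfl

open CategoryTheory Simplicial in
/-- The operadic composition, in each simplicial degree: `x ∘ (y_0 ⊔ ⋯ ⊔ y_{n-1})`. -/
def TW.comp {k n : ℕ} (m : Fin n → ℕ) (x : (TW n) _⦋k⦌) (y : ∀ i, (TW (m i)) _⦋k⦌) :
    (TW (∑ i, m i)) _⦋k⦌ :=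
  Hom.comp (tensorAll m y) x

/-! ### Nonsymmetric operads and `A_∞`-operads of simplicial sets -/

open CategoryTheory Simplicial in
/-- A unit and composition maps `P(n) × ∏ P(m_i) → P(∑ m_i)`, given in each simplicial degree, make
the sequence `P` of simplicial sets a nonsymmetric operad: they are maps of simplicial sets, and
they are unital and associative. Equations between elements of `P(n)` and `P(n')`, where `n = n'`
holds only propositionally, are stated in the disjoint union of all `P(n)`. -/
structure IsNonsymmetricOperad (P : ℕ → SSet.{0}) (unit : ∀ k : ℕ, (P 1) _⦋k⦌)
    (comp : ∀ {k n : ℕ} (m : Fin n → ℕ), (P n) _⦋k⦌ → (∀ i, (P (m i)) _⦋k⦌) →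
      (P (∑ i, m i)) _⦋k⦌) : Prop where
  map_unit {k l : ℕ} (θ : ⦋l⦌ ⟶ ⦋k⦌) : (P 1).map θ.op (unit k) = unit l
  map_comp {k l : ℕ} (θ : ⦋l⦌ ⟶ ⦋k⦌) {n : ℕ} (m : Fin n → ℕ) (x : (P n) _⦋k⦌)
    (y : ∀ i, (P (m i)) _⦋k⦌) :
    (P (∑ i, m i)).map θ.op (comp m x y) =
      comp m ((P n).map θ.op x) fun i => (P (m i)).map θ.op (y i)
  unit_comp {k n : ℕ} (x : (P n) _⦋k⦌) :
    (⟨_, comp (fun _ : Fin 1 => n) (unit k) fun _ => x⟩ : Σ n, (P n) _⦋k⦌) = ⟨n, x⟩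
  comp_unit {k n : ℕ} (x : (P n) _⦋k⦌) :
    (⟨_, comp (fun _ : Fin n => 1) x fun _ => unit k⟩ : Σ n, (P n) _⦋k⦌) = ⟨n, x⟩
  assoc {k n : ℕ} (m : Fin n → ℕ) (l : ∀ i, Fin (m i) → ℕ) (x : (P n) _⦋k⦌)
    (y : ∀ i, (P (m i)) _⦋k⦌) (z : ∀ i j, (P (l i j)) _⦋k⦌) :
    (⟨_, comp (fun q : Fin (∑ i, m i) =>
          l (finSigmaFinEquiv.symm q).1 (finSigmaFinEquiv.symm q).2) (comp m x y)
        fun q => z (finSigmaFinEquiv.symm q).1 (finSigmaFinEquiv.symm q).2⟩ :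
        Σ n, (P n) _⦋k⦌) =
      ⟨_, comp (fun i => ∑ j, l i j) x fun i => comp (l i) (y i) (z i)⟩

open CategoryTheory Simplicial in
/-- A simplicial set is contractible if it is simplicially homotopy equivalent to a point, that is,
if its identity and the constant map at some vertex `x` are related by the equivalence relation
generated by simplicial homotopy. -/
def IsContractible (X : SSet.{0}) : Prop :=
  ∃ x : X _⦋0⦌, Relation.EqvGen (fun f g : X ⟶ X => Nonempty (SimplicialObject.Homotopy f g))
    (SSet.const x) (𝟙 X)

open CategoryTheory Simplicial in
/-- An `A_∞`-operad of simplicial sets: a nonsymmetric operad all of whose spaces are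
contractible. -/
def IsAInftyOperad (P : ℕ → SSet.{0}) (unit : ∀ k : ℕ, (P 1) _⦋k⦌)
    (comp : ∀ {k n : ℕ} (m : Fin n → ℕ), (P n) _⦋k⦌ → (∀ i, (P (m i)) _⦋k⦌) →
      (P (∑ i, m i)) _⦋k⦌) : Prop :=
  IsNonsymmetricOperad P unit comp ∧ ∀ n, IsContractible (P n)

open CategoryTheory Simplicial in
/-- A left contraction (extra degeneracy) of a simplicial set augmented to a point: the point
`s_{-1}(*)` and maps `s_{-1} : X_k → X_{k+1}` such that `d_0 s_{-1} = id`,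
`d_i s_{-1} = s_{-1} d_{i-1}` for `i ≥ 1`, and `s_i s_{-1} = s_{-1} s_{i-1}` for `i ≥ 0`. -/
structure IsLeftContraction (X : SSet.{0}) (pt : X _⦋0⦌) (s : ∀ {k : ℕ}, X _⦋k⦌ → X _⦋k + 1⦌) :
    Prop where
  d_zero {k : ℕ} (x : X _⦋k⦌) : X.δ 0 (s x) = x
  d_one (x : X _⦋0⦌) : X.δ 1 (s x) = pt
  d_succ {k : ℕ} (x : X _⦋k + 1⦌) (i : Fin (k + 2)) : X.δ i.succ (s x) = s (X.δ i x)
  s_zero_pt : X.σ 0 pt = s pt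
  s_zero {k : ℕ} (x : X _⦋k⦌) : X.σ 0 (s x) = s (s x)
  s_succ {k : ℕ} (x : X _⦋k⦌) (i : Fin (k + 1)) : X.σ i.succ (s x) = s (X.σ i x)

/-! ### The explicit contraction -/

section

variable {k : ℕ}

/-- The functor `d^0 : B_k → B_{k+1}`, which increases all labels by one, on formal expressions. -/
def Diagram.shift {σ τ : Word k} : Diagram k σ τ → Mor (k + 1)
  | .id σ => Mor.id (σ.map Fin.succ)
  | .u a => Mor.u a.succ
  | .m a => Mor.m a.succ
  | .t a b _ => Mor.t a.succ b.succ
  | .comp f g => f.shift.comp g.shift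
  | .tensor f g => f.shift * g.shift

theorem Diagram.dom_cod_shift {σ τ : Word k} (f : Diagram k σ τ) :
    f.shift.dom = σ.map Fin.succ ∧ f.shift.cod = τ.map Fin.succ := by
  induction f with
  | t a b h => simp [Diagram.shift, Mor.cod_t (Fin.succ_lt_succ_iff.2 h)]
  | comp f g hf hg => simp [Diagram.shift, Mor.cod_comp, hf, hg]
  | _ => simp_all [Diagram.shift]

theorem Diagram.shift_eq {σ τ σ' τ' : Word k} {f : Diagram k σ τ}
    {g : Diagram k σ' τ'} (h : Eqv f g) : f.shift = g.shift := by
  induction h with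
  | refl f => rfl
  | symm _ ih => exact ih.symm
  | trans _ _ ih ih' => exact ih.trans ih'
  | comp_congr _ _ ih ih' => rw [Diagram.shift, Diagram.shift, ih, ih']
  | tensor_congr _ _ ih ih' => rw [Diagram.shift, Diagram.shift, ih, ih']
  | id_comp f => exact Mor.id_comp f.dom_cod_shift.1
  | comp_id f => exact Mor.comp_id f.dom_cod_shift.2
  | assoc f g h =>
    exact Mor.assoc (f.dom_cod_shift.2.trans g.dom_cod_shift.1.symm)
      (g.dom_cod_shift.2.trans h.dom_cod_shift.1.symm)
  | tensor_id σ τ => simp [Diagram.shift, Mor.id_mul_id]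
  | interchange f g f' g' =>
    exact Mor.interchange (f.dom_cod_shift.2.trans g.dom_cod_shift.1.symm)
      (f'.dom_cod_shift.2.trans g'.dom_cod_shift.1.symm)
  | nil_tensor f => exact one_mul _
  | tensor_nil f => exact mul_one _
  | tensor_assoc f g h => exact mul_assoc _ _ _
  | mul_unit a => exact Mor.mul_unit a.succ
  | unit_mul a => exact Mor.unit_mul a.succ
  | twist_unit c d h => exact Mor.twist_unit (Fin.succ_lt_succ_iff.2 h)
  | unit_twist c d h => exact Mor.unit_twist (Fin.succ_lt_succ_iff.2 h)

/-- The functor `d^0 : B_k → B_{k+1}`, which increases all labels by one, on all morphisms. -/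
def Mor.shift (f : Mor k) : Mor (k + 1) :=
  Quotient.lift (fun f : Arrow k => f.term.shift) (fun _ _ h => Diagram.shift_eq h) f

theorem Mor.dom_cod_shift (f : Mor k) :
    f.shift.dom = f.dom.map Fin.succ ∧ f.shift.cod = f.cod.map Fin.succ := by
  obtain ⟨_, _, f, rfl⟩ := f.exists_rep
  exact f.dom_cod_shift

/-- The functor `d^0 : B_k → B_{k+1}`, which increases all labels by one. -/
def Hom.shift {σ τ : Word k} (f : Hom σ τ) : Hom (σ.map Fin.succ) (τ.map Fin.succ) :=
  ⟨f.1.shift, by simp [f.1.dom_cod_shift, f.2]⟩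

end

/-- The braid morphisms of `B_1`; `braid j` is `β_{j + 2}`. -/
def braid : ℕ → Mor 1
  | 0 => (Mor.id [0] * Mor.t 1 0 * Mor.id [1]).comp (Mor.m 0 * Mor.id [1, 1])
  | j + 1 => (Mor.id (pow 1 (j + 1)) * braid 0).comp (braid j * Mor.id [1])

theorem braid_zero_dom : (braid 0).dom = pow 1 2 := by
  simp [braid]; rfl

theorem braid_zero_cod : (braid 0).cod = [0, 1, 1] := by
  rw [braid, Mor.cod_comp (by simp [Mor.cod_t])]
  simp

theorem braid_dom_cod (j : ℕ) :
    (braid j).dom = pow 1 (j + 2) ∧ (braid j).cod = 0 :: List.replicate (j + 2) 1 := by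
  induction j with
  | zero => exact ⟨braid_zero_dom, braid_zero_cod⟩
  | succ j ih =>
    have e : pow 1 (j + 1) ++ [0, 1, 1] = pow 1 (j + 2) ++ [1] := by
      rw [show j + 2 = j + 1 + 1 from rfl, pow_add 1 (j + 1) 1, List.append_assoc]; rfl
    constructor
    · rw [braid, Mor.dom_comp, Mor.dom_mul, braid_zero_dom, Mor.dom_id, ← pow_add]
    · rw [braid, Mor.cod_comp (by simp [braid_zero_cod, ih, e])]
      simp [ih, List.replicate_succ']

/-- The morphism `β_n : [1]^n → (0 1^n)`, where `n = j + 2`. -/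
def beta (j : ℕ) : Hom (pow 1 (j + 2)) (0 :: List.replicate (j + 2) 1) :=
  ⟨braid j, braid_dom_cod j⟩

/-- The map `[k + 1] → [1]` which sends `0` to `0` and everything else to `1`; it induces the
iterated degeneracy `s_1^k : B_1 → B_{k+1}`. -/
def collapse (k : ℕ) : Fin (k + 1 + 1) →o Fin (1 + 1) where
  toFun x := if x = 0 then 0 else 1
  monotone' x y h := by
    rcases eq_or_ne x 0 with rfl | hx
    · simp
    · have hy : y ≠ 0 := fun hy => hx (Fin.le_zero_iff.1 (hy ▸ h))
      simp [hx, hy]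

theorem collapse_apply (k : ℕ) (x : Fin (k + 1 + 1)) :
    collapse k x = if x = 0 then 0 else 1 := rfl

theorem pullWord_collapse (k n : ℕ) :
    pullWord (collapse k) (0 :: List.replicate n 1) = 0 :: (pow k n).map Fin.succ := by
  have h₀ : fiber (collapse k) 0 = [0] :=
    eq_of_pairwise (pairwise_fiber _ _) (by simp) (by simp [collapse_apply])
  have h₁ : fiber (collapse k) 1 = (List.finRange (k + 1)).map Fin.succ := by
    refine eq_of_pairwise (pairwise_fiber _ _)
      (List.Pairwise.map _ (fun _ _ h => Fin.succ_lt_succ_iff.2 h) (List.pairwise_lt_finRange _))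
      fun x => ?_
    cases x using Fin.cases <;> simp [collapse_apply]
  rw [pullWord_cons, h₀, List.singleton_append, List.cons_inj_right]
  induction n with
  | zero => rfl
  | succ n ih => rw [List.replicate_succ, pullWord_cons, h₁, ih, pow_succ, List.map_append]

/-- The morphism `Θ_{n,k+1} = s_1^k β_n : [k+1]^n → (0) ⊔ d^0([k]^n)`, where `n = j + 2`. -/
def Theta (j k : ℕ) : Hom (pow (k + 1) (j + 2)) (0 :: (pow k (j + 2)).map Fin.succ) :=
  ((beta j).pull (collapse k)).cast (pullWord_pow _ _) (pullWord_collapse k (j + 2))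

open CategoryTheory Simplicial in
/-- The vertex `τ(n) = d_1 β_n` of `TW(n)`, where `n = j + 2`. -/
def TW.vertex (j : ℕ) : (TW (j + 2)) _⦋0⦌ :=
  ((beta j).pull (Fin.succAboveOrderEmb 1).toOrderHom).cast (pullWord_pow _ _) (by
    have h₀ : fiber (l := 0) (k := 1) (Fin.succAboveOrderEmb 1).toOrderHom 0 = [0] := by decide
    have h₁ : fiber (l := 0) (k := 1) (Fin.succAboveOrderEmb 1).toOrderHom 1 = [] := by decide
    rw [pullWord_cons, h₀, pullWord, List.flatMap_eq_nil_iff.2 fun x hx => by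
      rw [List.eq_of_mem_replicate hx, h₁]]
    rfl)

open CategoryTheory Simplicial in
/-- The map `s_{-1}(φ) = ((0) ⊔ d^0 φ) ∘ Θ_{n,k+1}` from `TW(n)_k` to `TW(n)_{k+1}`, where
`n = j + 2`. -/
def TW.contraction (j : ℕ) {k : ℕ} (φ : (TW (j + 2)) _⦋k⦌) : (TW (j + 2)) _⦋k + 1⦌ :=
  (Theta j k).comp (((Hom.id [0]).tensor (Hom.shift φ)).cast rfl (List.finRange_succ).symm)

end TwistOperad

/-! The operad structure is formal: each `Mor.pull θ` is a strict monoidal functor, so it respects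
composites `x ∘ (y_1 ⊔ ⋯ ⊔ y_n)`, and the unit and associativity laws are those of a strict monoidal
category. The only combinatorial point is that flattening the double index of the inner morphisms
agrees with concatenating lists (`ofFn_finSigmaFinEquiv_symm`).

Contractibility comes from one morphism `β : [1]^n → (0 1^n)` with two properties, recorded in
`IsBraiding`: deleting the symbol 0 turns `β` into an identity, and `s_0 β = (id_0 ⊔ d^0 β) ∘ s_1
β`. Given such a `β`, set `s_{-1}(x) = (id_0 ⊔ d^0 x) ∘ s_1^k β`. Pulling this back along `θ` gives
`(id ⊔ θ^* d^0 x) ∘ (collapse ∘ θ)^* β` (`IsBraiding.pull_contraction`), so every identity of a left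
contraction becomes a comparison of monotone maps. Operators fixing 0 and acting as `θ` on the
positive symbols pass through `d^0` and leave the collapse map unchanged. For `d_0` the first
property removes `β`; in `d_1 s_{-1} = pt` all of `d^0 x` is deleted and `d_1 β` remains; the
identities for `s_0` are pullbacks of the second property.

The second property is thus the only real computation. For `β_2` both sides have the same crossings
followed by the same multiplications (`degeneracy_braid_zero`). For larger `n` it follows by
induction, because the last strand of `β_n` is never touched (`braid_eq_mul_id`) and so the factors
to be reordered act on disjoint strands. In arities 0 and 1 the morphisms `u^0` and `id_{(0 1)}`
play the role of `β`, so every `TW(n)` is contractible. -/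

namespace TwistOperad

/-! ### The functor `d^0` and its composites with the simplicial operators -/

section Shift

variable {k l : ℕ}

namespace Mor

theorem shift_mk {σ τ : Word k} (f : Diagram k σ τ) : (mk f).shift = f.shift := rfl

@[simp] theorem dom_shift (f : Mor k) : f.shift.dom = f.dom.map Fin.succ := f.dom_cod_shift.1

@[simp] theorem cod_shift (f : Mor k) : f.shift.cod = f.cod.map Fin.succ := f.dom_cod_shift.2

@[simp] theorem shift_id (σ : Word k) : (id σ).shift = id (σ.map Fin.succ) := rfl

@[simp] theorem shift_u (a : Fin (k + 1)) : (u a).shift = u a.succ := rfl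

@[simp] theorem shift_m (a : Fin (k + 1)) : (m a).shift = m a.succ := rfl

theorem shift_t {a b : Fin (k + 1)} (h : b < a) : (t a b).shift = t a.succ b.succ := by
  rw [t_eq h]; rfl

@[simp] theorem shift_mul (f g : Mor k) : (f * g).shift = f.shift * g.shift := by
  obtain ⟨_, _, f, rfl⟩ := f.exists_rep
  obtain ⟨_, _, g, rfl⟩ := g.exists_rep
  rfl

theorem shift_comp {f g : Mor k} (h : f.cod = g.dom) :
    (f.comp g).shift = f.shift.comp g.shift := by
  obtain ⟨_, _, f, rfl⟩ := f.exists_rep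
  obtain ⟨_, _, g, rfl⟩ := g.exists_rep
  dsimp at h
  subst h
  rw [comp_mk]; rfl

theorem shift_units (σ : Word k) : (units σ).shift = units (σ.map Fin.succ) := by
  induction σ with
  | nil => rfl
  | cons a σ ih => simp [units, ih]

theorem shift_cross₁ {c : Fin (k + 1)} {σ : Word k} (h : ∀ b ∈ σ, b < c) :
    (cross₁ c σ).shift = cross₁ c.succ (σ.map Fin.succ) := by
  induction σ with
  | nil => rfl
  | cons b σ ih =>
    have hb := h b (by simp)
    rw [cross₁, shift_comp (by simp [cod_t hb]), shift_mul, shift_mul, shift_t hb,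
      ih fun x hx => h x (by simp [hx])]
    simp [cross₁]

theorem shift_cross {τ σ : Word k} (h : ∀ c ∈ τ, ∀ b ∈ σ, b < c) :
    (cross τ σ).shift = cross (τ.map Fin.succ) (σ.map Fin.succ) := by
  induction τ with
  | nil => rfl
  | cons c τ ih =>
    have h₀ : ∀ x ∈ τ, ∀ b ∈ σ, b < x := fun x hx => h x (by simp [hx])
    rw [cross, shift_comp (by simp [cod_cross h₀]), shift_mul, shift_mul, ih h₀,
      shift_cross₁ (h c (by simp))]
    simp [cross]

theorem shift_join {σ : Word k} (h : σ.Pairwise (· < ·)) :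
    (join σ).shift = join (σ.map Fin.succ) := by
  induction σ with
  | nil => rfl
  | cons a σ ih =>
    obtain ⟨h₁, h₂⟩ := List.pairwise_cons.1 h
    have h₃ : ∀ c ∈ σ, ∀ b ∈ [a], b < c := by simpa using h₁
    rw [join, shift_comp (by simp [cod_cross h₃]), shift_mul, shift_mul, shift_mul, ih h₂,
      shift_cross h₃]
    simp [join]

/-- Both composites are monoidal functors, so generators suffice; there `H` identifies the fibres,
and `d^0` carries `units`, `join` and `cross` of a word to those of the shifted word. The hypothesis
fits operators that fix 0 and act as `θ` on the positive symbols. -/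
theorem pull_shift (φ : Fin (l + 1 + 1) →o Fin (k + 1 + 1)) (θ : Fin (l + 1) →o Fin (k + 1))
    (H : ∀ a, fiber φ a.succ = (fiber θ a).map Fin.succ) (f : Mor k) :
    f.shift.pull φ = (f.pull θ).shift := by
  have H' (σ : Word k) : pullWord φ (σ.map Fin.succ) = (pullWord θ σ).map Fin.succ := by
    induction σ with
    | nil => rfl
    | cons a σ ih => simp [ih, H]
  obtain ⟨_, _, f, rfl⟩ := f.exists_rep
  simp only [pull_mk, shift_mk]
  induction f with
  | id σ => simp [Diagram.pull, Diagram.shift, H']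
  | u a => simp [Diagram.pull, Diagram.shift, pull_u, shift_units, H]
  | m a => simp [Diagram.pull, Diagram.shift, pull_m, shift_join (pairwise_fiber θ a), H]
  | t a b h =>
    simp [Diagram.pull, Diagram.shift, pull_t φ (Fin.succ_lt_succ_iff.2 h),
      shift_cross (fiber_lt θ h), H]
  | comp f g hf hg =>
    rw [Diagram.pull, shift_comp (by simp), Diagram.shift,
      pull_comp _ (by simp [Diagram.dom_cod_shift]), hf, hg]
  | tensor f g hf hg => rw [Diagram.pull, shift_mul, Diagram.shift, pull_mul, hf, hg]

/-- Needed for `d_0`: with `φ` the zeroth coface and `θ` the identity, it says that `d_0` undoes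
`d^0`. -/
theorem pull_shift_of_fiber_eq (φ : Fin (l + 1) →o Fin (k + 1 + 1))
    (θ : Fin (l + 1) →o Fin (k + 1)) (H : ∀ a, fiber φ a.succ = fiber θ a) (f : Mor k) :
    f.shift.pull φ = f.pull θ := by
  have H' (σ : Word k) : pullWord φ (σ.map Fin.succ) = pullWord θ σ := by
    induction σ with
    | nil => rfl
    | cons a σ ih => simp [ih, H]
  obtain ⟨_, _, f, rfl⟩ := f.exists_rep
  simp only [pull_mk, shift_mk]
  induction f with
  | id σ => simp [Diagram.pull, Diagram.shift, H']
  | u a => simp [Diagram.pull, Diagram.shift, pull_u, H]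
  | m a => simp [Diagram.pull, Diagram.shift, pull_m, H]
  | t a b h => simp [Diagram.pull, Diagram.shift, pull_t φ (Fin.succ_lt_succ_iff.2 h), H]
  | comp f g hf hg =>
    rw [Diagram.pull, Diagram.shift, pull_comp _ (by simp [Diagram.dom_cod_shift]), hf, hg]
  | tensor f g hf hg => rw [Diagram.pull, Diagram.shift, pull_mul, hf, hg]

/-- Needed for `s_0`, which doubles only the symbol 0. Morphisms in the image of `d^0` do not
involve 0, so they are merely renumbered once more. -/
theorem pull_shift_eq_shift_shift (φ : Fin (k + 1 + 1 + 1) →o Fin (k + 1 + 1))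
    (H : ∀ a : Fin (k + 1), fiber φ a.succ = [a.succ.succ]) (f : Mor k) : f.shift.pull φ = f.shift.shift := by
  have H' (σ : Word k) : pullWord φ (σ.map Fin.succ) = (σ.map Fin.succ).map Fin.succ := by
    induction σ with
    | nil => rfl
    | cons a σ ih => simpa [H] using ih
  obtain ⟨_, _, f, rfl⟩ := f.exists_rep
  simp only [shift_mk]
  induction f with
  | id σ => simp [Diagram.shift, H']
  | u a => simp [Diagram.shift, pull_u, H, units]
  | m a => simp [Diagram.shift, pull_m, H, join_singleton]
  | t a b h =>
    have h' := Fin.succ_lt_succ_iff.2 h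
    simp [Diagram.shift, pull_t φ h', H, shift_t h', cross_singleton,
      cross₁_singleton (Fin.succ_lt_succ_iff.2 h')]
  | comp f g hf hg =>
    rw [Diagram.shift, pull_comp _ (by simp [Diagram.dom_cod_shift]), hf, hg,
      shift_comp (by simp [Diagram.dom_cod_shift])]
  | tensor f g hf hg => rw [Diagram.shift, pull_mul, hf, hg, shift_mul]

/-- Needed for `d_1` on `TW(n)_1`: every symbol occurring in `d^0 x` is deleted. -/
theorem pull_shift_eq_one (φ : Fin (l + 1) →o Fin (k + 1 + 1))
    (H : ∀ a : Fin (k + 1), fiber φ a.succ = []) (f : Mor k) : f.shift.pull φ = 1 := by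
  have H' (σ : Word k) : pullWord φ (σ.map Fin.succ) = [] := by
    induction σ with
    | nil => rfl
    | cons a σ ih => simpa [H] using ih
  obtain ⟨_, _, f, rfl⟩ := f.exists_rep
  simp only [shift_mk]
  induction f with
  | id σ => simp [Diagram.shift, H']
  | u a => simp [Diagram.shift, pull_u, H, units]
  | m a => simp [Diagram.shift, pull_m, H, join]
  | t a b h => simp [Diagram.shift, pull_t φ (Fin.succ_lt_succ_iff.2 h), H, cross]
  | comp f g hf hg =>
    rw [Diagram.shift, pull_comp _ (by simp [Diagram.dom_cod_shift]), hf, hg, one_comp_one]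
  | tensor f g hf hg => rw [Diagram.shift, pull_mul, hf, hg, one_mul]

end Mor

end Shift

/-! ### Contractions from braid morphisms -/

/-- A morphism `β : [1]^n → (0 1^n)` which the face `d_0` sends to an identity and for which
`s_0 β = ((0) ⊔ d^0 β) ∘ s_1 β`. -/
structure IsBraiding (n : ℕ) (b : Mor 1) : Prop where
  dom_eq : b.dom = pow 1 n
  cod_eq : b.cod = 0 :: List.replicate n 1
  pull_eq_id {k : ℕ} (φ : Fin (k + 1) →o Fin (1 + 1)) (h : fiber φ 0 = []) :
    b.pull φ = Mor.id (pow k n)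
  degeneracy : b.pull (Fin.predAboveOrderHom (0 : Fin (1 + 1))) =
    (b.pull (collapse 1)).comp (Mor.id [0] * b.shift)

theorem fiber_degeneracy_zero : fiber (Fin.predAboveOrderHom (0 : Fin (1 + 1))) 0 = [0, 1] := by
  decide

theorem fiber_degeneracy_one : fiber (Fin.predAboveOrderHom (0 : Fin (1 + 1))) 1 = [2] := by
  decide

theorem fiber_collapse_one_zero : fiber (collapse 1) 0 = [0] := by decide

theorem fiber_collapse_one_one : fiber (collapse 1) 1 = [1, 2] := by decide

/-- Since `s_0 u^0 = u^0 ⊔ u^1`, the degeneracy relation only says that the symbol 0 may be created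
first and the symbol 1 afterwards. -/
theorem isBraiding_u : IsBraiding 0 (Mor.u 0) where
  dom_eq := rfl
  cod_eq := rfl
  pull_eq_id φ h := by rw [Mor.pull_u, h]; rfl
  degeneracy := by
    rw [Mor.pull_u, Mor.pull_u, fiber_degeneracy_zero, fiber_collapse_one_zero, Mor.shift_u]
    have := Mor.mul_eq_comp (k := 2) (Mor.u 0) (Mor.u 1)
    simpa [Mor.units] using this

theorem isBraiding_id : IsBraiding 1 (Mor.id [0, 1]) where
  dom_eq := rfl
  cod_eq := rfl
  pull_eq_id φ h := by rw [← pullWord_pow φ 1]; rfl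
  degeneracy := by
    simp only [Mor.pull_id, Mor.shift_id, Mor.id_mul_id, pullWord_cons, pullWord_nil,
      fiber_degeneracy_zero, fiber_degeneracy_one, fiber_collapse_one_zero, fiber_collapse_one_one]
    exact (Mor.id_comp rfl).symm

open Mor in
-- With no symbol over 0, `m^0` and `t^{1,0}` go to identities, and these are the only generators in
-- `β_n`. All such `φ` are allowed, not just the coface `d_0`, so that the result applies directly
-- to `collapse k` composed with a coface.
theorem pull_braid_eq_id {k : ℕ} (φ : Fin (k + 1) →o Fin (1 + 1)) (h : fiber φ 0 = []) (j : ℕ) :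
    (braid j).pull φ = Mor.id (pow k (j + 2)) := by
  have h1 : fiber φ 1 = List.finRange (k + 1) := by
    -- The fibres over 0 and 1 concatenate to the whole of `[k]`, and the first one is empty.
    have := pullWord_finRange φ
    simpa [List.finRange_succ, h] using this
  induction j with
  | zero =>
    rw [braid, pull_comp _ (by simp [cod_t])]
    simp [pull_t, pull_m, h, h1, cross_nil, join, id_mul_id, pow_succ, pow_zero]
  | succ j ih =>
    have h0 : (braid 0).pull φ = Mor.id (pow k 2) := by
      rw [braid, pull_comp _ (by simp [cod_t])]
      simp [pull_t, pull_m, h, h1, cross_nil, join, id_mul_id, pow_succ, pow_zero]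
    have hd := (braid_dom_cod j).1
    have hc := braid_zero_cod
    have w : pow 1 (j + 1) ++ [0, 1, 1] = pow 1 (j + 2) ++ [1] := by
      rw [show j + 2 = j + 1 + 1 from rfl, pow_add 1 (j + 1) 1, List.append_assoc]; rfl
    rw [braid, pull_comp _ (by simp [hd, hc, w])]
    simp only [pull_mul, pull_id, h0, ih, id_mul_id, pullWord_pow, pullWord_cons, pullWord_nil, h1]
    rw [← pow_add, List.append_nil, ← pow_one k, ← pow_add]
    exact id_comp_id _

end TwistOperad

/-! ### The relation `s_0 β = (id_0 ⊔ d^0 β) ∘ s_1 β` for the braid morphisms -/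

namespace TwistOperad

open Mor

/-- Together with `mul_assoc` this splits identities into single strands, a normal form in which
equal layers of a diagram agree syntactically. -/
theorem Mor.id_cons_cons {k : ℕ} (a b : Fin (k + 1)) (σ : Word k) :
    (Mor.id (a :: b :: σ) : Mor k) = Mor.id [a] * Mor.id (b :: σ) :=
  (id_mul_id [a] (b :: σ)).symm

/-- Both sides reduce to three layers on `(0 1 2 0 1 2)`: the crossing of 2 with 0, the simultaneous
crossings of 1 with 0 and of 2 with 1, and the multiplications of the 0s and the 1s. -/
theorem degeneracy_braid_zero : (braid 0).pull (Fin.predAboveOrderHom (0 : Fin (1 + 1))) =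
    ((braid 0).pull (collapse 1)).comp (Mor.id [0] * (braid 0).shift) := by
  have ht : (t 1 0 : Mor 1).cod = [0, 1] := cod_t (by decide)
  have ht₁ : (t 1 0 : Mor 2).cod = [0, 1] := cod_t (by decide)
  have ht₂ : (t 2 0 : Mor 2).cod = [0, 2] := cod_t (by decide)
  have ht₃ : (t 2 1 : Mor 2).cod = [1, 2] := cod_t (by decide)
  -- The two crossings of the middle layer are disjoint and may be done in either order: `s_0 β_2`
  -- yields `t 2 1` first, the other side yields `t 1 0` first.
  have hx : (t 1 0 * t 2 1 : Mor 2) =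
      (Mor.id [1, 0] * t 2 1).comp (t 1 0 * Mor.id [1, 2]) := by
    simpa [ht₁, ht₃] using mul_eq_comp' (t 1 0 : Mor 2) (t 2 1)
  have hx' : (t 1 0 * t 2 1 : Mor 2) =
      (t 1 0 * Mor.id [2, 1]).comp (Mor.id [0, 1] * t 2 1) := by
    simpa [ht₁, ht₃] using mul_eq_comp (t 1 0 : Mor 2) (t 2 1)
  have hL : (braid 0).pull (Fin.predAboveOrderHom (0 : Fin (1 + 1))) =
      (Mor.id [0, 1] * t 2 0 * Mor.id [1, 2]).comp
        ((Mor.id [0] * (t 1 0 * t 2 1) * Mor.id [2]).comp (m 0 * m 1 * Mor.id [2, 2])) := by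
    have hc : cross [2] [0, 1] = (t 2 0 * Mor.id [1]).comp (Mor.id [0] * t 2 1 : Mor 2) := by
      rw [cross_singleton, cross₁, cross₁_singleton (by decide)]
    have hj : (join [0, 1] : Mor 2) = (Mor.id [0] * t 1 0 * Mor.id [1]).comp (m 0 * m 1) := by
      rw [join, cross_singleton, cross₁_singleton (by decide), join_singleton]
    rw [braid, pull_comp _ (by simp [ht])]
    simp only [pull_mul, pull_id, pull_m, pull_t _ (show (0 : Fin (1 + 1)) < 1 by decide),
      pullWord_cons, pullWord_nil, fiber_degeneracy_zero, fiber_degeneracy_one, hc, hj,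
      List.append_nil, List.cons_append, List.nil_append]
    rw [id_mul_comp (by simp [ht₂]), comp_mul_id (by simp [ht₂]), comp_mul_id (by simp [ht₁]), hx,
      id_mul_comp (by simp [ht₃]), comp_mul_id (by simp [ht₃]),
      assoc (by simp [ht₂]) (by simp [ht₃]), assoc (by simp [ht₃]) (by simp [ht₁])]
    simp only [id_cons_cons, mul_assoc]
  have hR : ((braid 0).pull (collapse 1)).comp (Mor.id [0] * (braid 0).shift) =
      (Mor.id [0, 1] * t 2 0 * Mor.id [1, 2]).comp
        ((Mor.id [0] * (t 1 0 * t 2 1) * Mor.id [2]).comp (m 0 * m 1 * Mor.id [2, 2])) := by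
    have hc : cross [1, 2] [0] = (Mor.id [1] * t 2 0).comp (t 1 0 * Mor.id [2] : Mor 2) := by
      rw [cross, cross_singleton, cross₁_singleton (by decide), cross₁_singleton (by decide)]
    have hm : (m 0 * m 1 : Mor 2) = (m 0 * Mor.id [1, 1]).comp (Mor.id [0] * m 1) := by
      simpa using mul_eq_comp (m 0 : Mor 2) (m 1)
    -- On this side the 0s are multiplied before 2 crosses 1; the strands are disjoint, so the
    -- multiplication can be postponed.
    have hx₂ : (m 0 * Mor.id [1, 2, 1, 2]).comp (Mor.id [0] * (Mor.id [1] * t 2 1 * Mor.id [2])) =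
        (Mor.id [0, 0] * (Mor.id [1] * t 2 1 * Mor.id [2])).comp
          (m 0 * Mor.id [1, 1, 2, 2] : Mor 2) :=
      exchange (by simp) (by simp) (by simp) (by simp [ht₃])
    rw [braid, pull_comp _ (by simp [ht]), shift_comp (by simp [ht])]
    simp only [pull_mul, pull_id, pull_m, pull_t _ (show (0 : Fin (1 + 1)) < 1 by decide),
      pullWord_cons, pullWord_nil, fiber_collapse_one_zero, fiber_collapse_one_one, hc,
      join_singleton, List.append_nil, List.cons_append, List.nil_append, shift_mul, shift_id,
      shift_m, shift_t (show (0 : Fin (1 + 1)) < 1 by decide), List.map_cons, List.map_nil,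
      show (Fin.succ 1 : Fin (1 + 1 + 1)) = 2 from rfl,
      show (Fin.succ 0 : Fin (1 + 1 + 1)) = 1 from rfl]
    rw [hx', hm, id_mul_comp (f := Mor.id [1] * t 2 0) (by simp [ht₂]),
      comp_mul_id (f := Mor.id [0] * (Mor.id [1] * t 2 0)) (by simp [ht₂]),
      id_mul_comp (f := Mor.id [1] * t 2 1 * Mor.id [2]) (by simp [ht₃]),
      id_mul_comp (f := t 1 0 * Mor.id [2, 1]) (by simp [ht₁]),
      comp_mul_id (f := Mor.id [0] * (t 1 0 * Mor.id [2, 1])) (by simp [ht₁]),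
      comp_mul_id (f := m 0 * Mor.id [1, 1]) (by simp),
      assoc (by rw [cod_comp (by simp [ht₂])]; simp [ht₁]) (by simp),
      assoc (by simp [ht₂]) (by simp [ht₁]), assoc (by simp [ht₁]) (by simp [ht₃]),
      ← assoc (f := m 0 * Mor.id [1, 2, 1, 2]) (by simp) (by simp [ht₃]), hx₂,
      assoc (by simp [ht₃]) (by simp)]
    simp only [id_cons_cons, mul_assoc]
  rw [hL, hR]

/-- The only strands that move are a 0 and the 1 just before it, so the final 1 splits off as an
identity. No induction is needed: `β_{n+1}` starts with `β_2` on the last four symbols and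
afterwards keeps the last symbol fixed by definition. -/
theorem braid_eq_mul_id (j : ℕ) : ∃ g : Mor 1, g.dom = pow 1 (j + 1) ++ [0] ∧
    g.cod = 0 :: List.replicate (j + 1) 1 ∧ braid j = g * Mor.id [1] := by
  have ht : (t 1 0 : Mor 1).cod = [0, 1] := cod_t (by decide)
  have h₀ : braid 0 = (Mor.id [0] * t 1 0).comp (m 0 * Mor.id [1]) * Mor.id [1] := by
    rw [comp_mul_id (by simp [ht]), mul_assoc (m 0), id_mul_id, braid]; rfl
  cases j with
  | zero =>
    refine ⟨_, ?_, ?_, h₀⟩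
    · simp; rfl
    · rw [cod_comp (by simp [ht])]; simp
  | succ j =>
    obtain ⟨hd, hc⟩ := braid_dom_cod j
    have w : pow 1 (j + 1) ++ [0, 1] = pow 1 (j + 2) := by
      rw [show j + 2 = j + 1 + 1 from rfl, pow_add 1 (j + 1) 1]; rfl
    have hg : (Mor.id (pow 1 (j + 1)) * (Mor.id [0] * t 1 0).comp (m 0 * Mor.id [1])).cod =
        (braid j).dom := by
      rw [cod_mul, cod_comp (by simp [ht])]; simpa [hd] using w
    refine ⟨(Mor.id (pow 1 (j + 1)) * (Mor.id [0] * t 1 0).comp (m 0 * Mor.id [1])).comp (braid j),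
      ?_, ?_, ?_⟩
    · rw [dom_comp, ← w]; simp
    · rw [cod_comp hg, hc]
    · rw [comp_mul_id hg, braid, h₀, mul_assoc]

/-- Expanding `s_0 β_{n+1}` by the relations for `β_2` and `β_n` gives the four factors of the
right-hand side with the middle two in the wrong order. These two commute once `s_1 β_n` is written
as a morphism `⊔ id_{(1 2)}`. -/
theorem degeneracy_braid (j : ℕ) : (braid j).pull (Fin.predAboveOrderHom (0 : Fin (1 + 1))) =
    ((braid j).pull (collapse 1)).comp (Mor.id [0] * (braid j).shift) := by
  induction j with
  | zero => exact degeneracy_braid_zero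
  | succ j ih =>
    obtain ⟨g, hgd, hgc, hg⟩ := braid_eq_mul_id j
    obtain ⟨hd, hc⟩ := braid_dom_cod j
    have hd₀ := braid_zero_dom
    have hc₀ := braid_zero_cod
    have w : pow 1 (j + 1) ++ [0, 1, 1] = pow 1 (j + 2) ++ [1] := by
      rw [show j + 2 = j + 1 + 1 from rfl, pow_add 1 (j + 1) 1, List.append_assoc]; rfl
    have hcd : (Mor.id (pow 1 (j + 1)) * braid 0).cod = (braid j * Mor.id [1]).dom := by
      simp [hd, hc₀, w]
    have hb : (Mor.id [0] * (braid 0).shift).dom = [0, 1, 2, 1, 2] := by simp [hd₀]; rfl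
    have hq : ((braid 0).pull (collapse 1)).cod = [0, 1, 2, 1, 2] := by
      rw [cod_pull, hc₀]; decide
    have hgc' : (g.pull (collapse 1)).cod = 0 :: (pow 1 (j + 1)).map Fin.succ := by
      rw [cod_pull, hgc, pullWord_collapse]
    have hgd' : (g.pull (collapse 1)).dom = pow 2 (j + 1) ++ [0] := by
      rw [dom_pull, hgd, pullWord_append, pullWord_pow]; rfl
    have hbd : (braid j).shift.dom = (pow 1 (j + 1)).map Fin.succ ++ [1, 2] := by
      rw [dom_shift, hd, show j + 2 = j + 1 + 1 from rfl, pow_add 1 (j + 1) 1, List.map_append]; rfl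
    have hs : (braid 0).shift.dom = [1, 2, 1, 2] := by rw [dom_shift, hd₀]; rfl
    have hs' : (braid 0).shift.cod = [1, 2, 2] := by rw [cod_shift, hc₀]; rfl
    have hQ : (braid j).pull (collapse 1) = g.pull (collapse 1) * Mor.id [1, 2] := by
      rw [hg, pull_mul]; rfl
    -- The exchange of the middle factors: `d^0 β_2` acts on the last symbols `1 2 1 2`, and `s_1
    -- β_n` only on the strands before them.
    have hX : (Mor.id (pow 2 (j + 1)) * (Mor.id [0] * (braid 0).shift)).comp
          (g.pull (collapse 1) * Mor.id [1, 2, 2]) =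
        (g.pull (collapse 1) * Mor.id [1, 2, 1, 2]).comp
          (Mor.id (0 :: (pow 1 (j + 1)).map Fin.succ) * (braid 0).shift) := by
      rw [← mul_assoc, id_mul_id]
      exact (exchange hgd' hgc' hs hs').symm
    rw [braid, pull_comp _ hcd, pull_mul, pull_mul, ih, degeneracy_braid_zero, shift_comp hcd,
      pull_comp _ hcd, shift_mul, shift_mul, pull_mul, pull_mul, hQ]
    simp only [pull_id, shift_id, pullWord_pow, pullWord_cons, pullWord_nil, fiber_degeneracy_one,
      fiber_collapse_one_one, List.append_nil, List.map_cons, List.map_nil,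
      show (Fin.succ 1 : Fin (1 + 1 + 1)) = 2 from rfl]
    have h₁ : (g.pull (collapse 1) * Mor.id [1, 2]).cod = (Mor.id [0] * (braid j).shift).dom := by
      simp only [cod_mul, dom_mul, hgc', hbd, cod_id, dom_id]; simp
    have h₂ : (Mor.id (List.map Fin.succ (pow 1 (j + 1))) * (braid 0).shift).cod =
        ((braid j).shift * Mor.id [2]).dom := by
      simp only [cod_mul, dom_mul, hs', hbd, cod_id, dom_id]; simp
    rw [id_mul_comp (hq.trans hb.symm), comp_mul_id h₁, id_mul_comp h₂, mul_assoc _ (Mor.id [1, 2]),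
      id_mul_id, mul_assoc (g.pull (collapse 1)) (Mor.id [1, 2]), id_mul_id]
    -- Composition in `Mor` is total with an irrelevant value off composable pairs, so re-bracketing
    -- needs the words at each joint to match; `e₁` to `e₆` check this.
    have e₁ : (Mor.id (pow 2 (j + 1)) * (braid 0).pull (collapse 1)).cod =
        (g.pull (collapse 1) * Mor.id [1, 2, 1, 2]).dom := by
      simp only [cod_mul, dom_mul, hq, hgd', cod_id, dom_id]; simp
    have e₂ : (Mor.id (pow 2 (j + 1)) * (braid 0).pull (collapse 1)).cod =
        (Mor.id (pow 2 (j + 1)) * (Mor.id [0] * (braid 0).shift)).dom := by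
      simp only [cod_mul, dom_mul, hq, hs, cod_id, dom_id]; simp
    have e₃ : (Mor.id (pow 2 (j + 1)) * (Mor.id [0] * (braid 0).shift)).cod =
        (g.pull (collapse 1) * Mor.id [1, 2, 2]).dom := by
      simp only [cod_mul, dom_mul, hs', hgd', cod_id, dom_id]; simp
    have e₄ : (g.pull (collapse 1) * Mor.id [1, 2, 2]).cod =
        (Mor.id [0] * (braid j).shift * Mor.id [2]).dom := by
      simp only [cod_mul, dom_mul, hgc', hbd, cod_id, dom_id]; simp
    have e₅ : (g.pull (collapse 1) * Mor.id [1, 2, 1, 2]).cod =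
        (Mor.id (0 :: (pow 1 (j + 1)).map Fin.succ) * (braid 0).shift).dom := by
      simp only [cod_mul, dom_mul, hgc', hs, cod_id, dom_id]
    have e₆ : (Mor.id (0 :: (pow 1 (j + 1)).map Fin.succ) * (braid 0).shift).cod =
        (Mor.id [0] * (braid j).shift * Mor.id [2]).dom := by
      simp only [cod_mul, dom_mul, hs', hbd, cod_id, dom_id]; simp
    have hl : (Mor.id [0] * (Mor.id ((pow 1 (j + 1)).map Fin.succ) * (braid 0).shift)) =
        Mor.id (0 :: (pow 1 (j + 1)).map Fin.succ) * (braid 0).shift := by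
      rw [← mul_assoc, id_mul_id]; rfl
    simp only [List.cons_append, List.nil_append]
    rw [hl, ← mul_assoc (Mor.id [0]) (braid j).shift, assoc e₂ (by rw [dom_comp]; exact e₃),
      ← assoc e₃ e₄, hX, assoc e₅ e₆, assoc e₁ (by rw [dom_comp]; exact e₅)]

theorem isBraiding_braid (j : ℕ) : IsBraiding (j + 2) (braid j) where
  dom_eq := (braid_dom_cod j).1
  cod_eq := (braid_dom_cod j).2
  pull_eq_id φ h := pull_braid_eq_id φ h j
  degeneracy := degeneracy_braid j

end TwistOperad

/-! ### Simplicial operators applied to `(id_0 ⊔ d^0 x) ∘ s_1^k β` -/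

namespace TwistOperad

/-- The extension of a monotone map `θ : [l] → [k]` to `[l + 1] → [k + 1]` by `0 ↦ 0`. -/
def consZero {l k : ℕ} (θ : Fin (l + 1) →o Fin (k + 1)) : Fin (l + 1 + 1) →o Fin (k + 1 + 1) where
  toFun := Fin.cases 0 fun x => (θ x).succ
  monotone' x y h := by
    cases x using Fin.cases with
    | zero => exact Fin.zero_le _
    | succ x =>
      cases y using Fin.cases with
      | zero => exact absurd h (by simp)
      | succ y => exact Fin.succ_le_succ_iff.2 (θ.monotone (Fin.succ_le_succ_iff.1 h))

section

variable {l k : ℕ} (θ : Fin (l + 1) →o Fin (k + 1))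

@[simp] theorem consZero_zero : consZero θ 0 = 0 := rfl

@[simp] theorem consZero_succ (x : Fin (l + 1)) : consZero θ x.succ = (θ x).succ := rfl

/-- Stated through the values of `φ`, so that it covers the operators `d_{i+1}` and `s_{i+1}` as
well as `consZero θ`. -/
theorem fiber_succ_of_apply {φ : Fin (l + 1 + 1) →o Fin (k + 1 + 1)} (h : φ 0 = 0)
    (H : ∀ x : Fin (l + 1), φ x.succ = (θ x).succ) (a : Fin (k + 1)) :
    fiber φ a.succ = (fiber θ a).map Fin.succ := by
  refine eq_of_pairwise (pairwise_fiber _ _)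
    (List.Pairwise.map _ (fun _ _ h => Fin.succ_lt_succ_iff.2 h) (pairwise_fiber θ a)) fun x => ?_
  cases x using Fin.cases with
  | zero => simpa [h] using (Fin.succ_ne_zero a).symm
  | succ x => simp [H]

theorem fiber_zero_of_apply {φ : Fin (l + 1 + 1) →o Fin (k + 1 + 1)} (h : φ 0 = 0)
    (H : ∀ x : Fin (l + 1), φ x.succ = (θ x).succ) : fiber φ 0 = [0] := by
  refine eq_of_pairwise (pairwise_fiber _ _) (by simp) fun x => ?_
  cases x using Fin.cases with
  | zero => simp [h]
  | succ x => simp [H]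

end

namespace IsBraiding

variable {n : ℕ} {b : Mor 1} {k l : ℕ}

theorem dom_pull (hb : IsBraiding n b) (θ : Fin (k + 1) →o Fin (1 + 1)) : (b.pull θ).dom = pow k n := by
  rw [Mor.dom_pull, hb.dom_eq, pullWord_pow]

theorem cod_pull_collapse (hb : IsBraiding n b) (k : ℕ) :
    (b.pull (collapse k)).cod = 0 :: (pow k n).map Fin.succ := by
  rw [Mor.cod_pull, hb.cod_eq, pullWord_collapse]

/-- The degeneracy relation pulled back along `consZero θ`. Both `s_0` identities of the contraction
are instances: `θ` is a coface for the vertex and `collapse k` for `s_0 s_{-1}`. -/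
theorem pull_degeneracy_comp (hb : IsBraiding n b) (θ : Fin (l + 1) →o Fin (1 + 1)) :
    b.pull ((Fin.predAboveOrderHom (0 : Fin (1 + 1))).comp (consZero θ)) =
      (b.pull (collapse l)).comp (Mor.id [0] * (b.pull θ).shift) := by
  have h₁ : (collapse 1).comp (consZero θ) = collapse l := by
    ext x
    cases x using Fin.cases <;> simp [collapse_apply]
  have h₂ := congrArg (Mor.pull (consZero θ)) hb.degeneracy
  rwa [Mor.pull_pull, Mor.pull_comp _ (by simp [hb.cod_pull_collapse, hb.dom_eq]), Mor.pull_pull,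
    h₁, Mor.pull_mul, Mor.pull_shift _ θ (fiber_succ_of_apply θ rfl fun _ => rfl), Mor.pull_id,
    pullWord_cons, fiber_zero_of_apply θ rfl fun _ => rfl] at h₂

theorem comp_cond (hb : IsBraiding n b) {x : Mor k} (hx : x.dom = pow k n) :
    (b.pull (collapse k)).cod = (Mor.id [0] * x.shift).dom := by
  simp [hb.cod_pull_collapse, hx]

theorem pull_contraction (hb : IsBraiding n b) (θ : Fin (l + 1) →o Fin (k + 1 + 1)) {x : Mor k}
    (hx : x.dom = pow k n) :
    ((b.pull (collapse k)).comp (Mor.id [0] * x.shift)).pull θ =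
      (b.pull ((collapse k).comp θ)).comp (Mor.id (fiber θ 0) * x.shift.pull θ) := by
  rw [Mor.pull_comp _ (hb.comp_cond hx), Mor.pull_pull, Mor.pull_mul, Mor.pull_id]
  simp

/-- Collapsing all positive symbols does not see how `φ` acts among them, so the factor built from
`β` keeps its shape. This handles `d_{i+1}` and `s_{i+1}` at once. -/
theorem pull_contraction_of_succ (hb : IsBraiding n b) {φ : Fin (l + 1 + 1) →o Fin (k + 1 + 1)}
    {θ : Fin (l + 1) →o Fin (k + 1)} (h : φ 0 = 0) (H : ∀ x : Fin (l + 1), φ x.succ = (θ x).succ)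
    {x : Mor k} (hx : x.dom = pow k n) :
    ((b.pull (collapse k)).comp (Mor.id [0] * x.shift)).pull φ =
      (b.pull (collapse l)).comp (Mor.id [0] * (x.pull θ).shift) := by
  have h₁ : (collapse k).comp φ = collapse l := by
    ext x
    cases x using Fin.cases <;> simp [collapse_apply, h, H]
  rw [hb.pull_contraction φ hx, h₁, Mor.pull_shift φ θ (fiber_succ_of_apply θ h H),
    fiber_zero_of_apply θ h H]

end IsBraiding

/-! ### The left contraction and contractibility of `TW(n)` -/

open CategoryTheory Simplicial

/-- The vertex `d_1 β` of `TW(n)`. -/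
def braidingVertex {n : ℕ} (b : Hom (pow 1 n) (0 :: List.replicate n 1)) : (TW n) _⦋0⦌ :=
  ⟨b.1.pull (Fin.succAboveOrderEmb 1).toOrderHom, by
    rw [Mor.dom_pull, b.2.1, pullWord_pow], by
    have h₀ : fiber (l := 0) (k := 1) (Fin.succAboveOrderEmb 1).toOrderHom 0 = [0] := by decide
    have h₁ : fiber (l := 0) (k := 1) (Fin.succAboveOrderEmb 1).toOrderHom 1 = [] := by decide
    rw [Mor.cod_pull, b.2.2, pullWord_cons, h₀, pullWord,
      List.flatMap_eq_nil_iff.2 fun x hx => by rw [List.eq_of_mem_replicate hx, h₁]]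
    rfl⟩

/-- The map `φ ↦ ((0) ⊔ d^0 φ) ∘ s_1^k β` from `TW(n)_k` to `TW(n)_{k+1}`. -/
def braidingContraction {n : ℕ} (b : Hom (pow 1 n) (0 :: List.replicate n 1)) {k : ℕ}
    (φ : (TW n) _⦋k⦌) : (TW n) _⦋k + 1⦌ :=
  ((b.pull (collapse k)).cast (pullWord_pow _ _) (pullWord_collapse k n)).comp
    (((Hom.id [0]).tensor (Hom.shift φ)).cast rfl (List.finRange_succ).symm)

theorem isLeftContraction_of_isBraiding {n : ℕ} (b : Hom (pow 1 n) (0 :: List.replicate n 1))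
    (hb : IsBraiding n b.1) :
    IsLeftContraction (TW n) (braidingVertex b) (braidingContraction b) where
  d_zero {k} x := by
    refine Hom.ext ?_
    obtain ⟨x, hx, hx'⟩ := x
    change ((b.1.pull (collapse k)).comp (Mor.id [0] * x.shift)).pull
      (Fin.succAboveOrderEmb 0).toOrderHom = x
    -- The strand 0 disappears, `d_0` cancels `d^0`, and `β` is pulled back along a map that misses
    -- 0, hence becomes an identity.
    rw [hb.pull_contraction _ hx, fiber_face_self,
      Mor.pull_shift_of_fiber_eq _ OrderHom.id fun a => by
        rw [fiber_id]; exact fiber_face 0 a,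
      Mor.pull_id_eq, hb.pull_eq_id, Mor.id_nil, one_mul]
    · exact Mor.id_comp hx
    · exact List.eq_nil_iff_forall_not_mem.2 fun x => by simp [collapse_apply]
  d_one x := by
    refine Hom.ext ?_
    obtain ⟨x, hx, hx'⟩ := x
    change ((b.1.pull (collapse 0)).comp (Mor.id [0] * x.shift)).pull
      (Fin.succAboveOrderEmb 1).toOrderHom = b.1.pull (Fin.succAboveOrderEmb 1).toOrderHom
    have h₀ : fiber (l := 0) (k := 1) (Fin.succAboveOrderEmb 1).toOrderHom 0 = [0] := by decide
    have h₁ : fiber (l := 0) (k := 1) (Fin.succAboveOrderEmb 1).toOrderHom 1 = [] := by decide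
    have h₂ : (collapse 0).comp (Fin.succAboveOrderEmb 1).toOrderHom =
        (Fin.succAboveOrderEmb (n := 1) 1).toOrderHom := by
      ext x; fin_cases x; rfl
    rw [hb.pull_contraction _ hx, h₂, Mor.pull_shift_eq_one _ (by simpa using h₁), h₀, mul_one]
    exact Mor.comp_id (braidingVertex b).2.2
  d_succ {k} x i := by
    refine Hom.ext ?_
    obtain ⟨x, hx, hx'⟩ := x
    exact hb.pull_contraction_of_succ (φ := (Fin.succAboveOrderEmb i.succ).toOrderHom)
      (θ := (Fin.succAboveOrderEmb i).toOrderHom) (by simp) (by simp) hx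
  s_zero_pt := by
    refine Hom.ext ?_
    change (b.1.pull _).pull (Fin.predAboveOrderHom (0 : Fin 1)) = _
    rw [Mor.pull_pull]
    -- Both maps `[1] → [1]` are constant at 0: `d_1` followed by `s_0` corresponds to the map
    -- through `[0]`, and the other one is the zeroth codegeneracy after `consZero` of the coface.
    refine Eq.trans (congrArg (fun θ => b.1.pull θ) ?_)
      (hb.pull_degeneracy_comp (Fin.succAboveOrderEmb 1).toOrderHom)
    ext x
    fin_cases x <;> rfl
  s_zero {k} x := by
    refine Hom.ext ?_
    obtain ⟨x, hx, hx'⟩ := x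
    change ((b.1.pull (collapse k)).comp (Mor.id [0] * x.shift)).pull
        (Fin.predAboveOrderHom (0 : Fin (k + 1 + 1))) =
      (b.1.pull (collapse (k + 1))).comp
        (Mor.id [0] * ((b.1.pull (collapse k)).comp (Mor.id [0] * x.shift)).shift)
    have h₀ (a : Fin (k + 1)) :
        fiber (Fin.predAboveOrderHom (0 : Fin (k + 1 + 1))) a.succ = [a.succ.succ] := by
      rw [fiber_degeneracy _ (Fin.succ_ne_zero a), if_neg (by simp)]
    have h₀' : fiber (Fin.predAboveOrderHom (0 : Fin (k + 1 + 1))) 0 = [0, 1] :=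
      fiber_degeneracy_self 0
    -- Both maps send 0 and 1 to 0 and everything else to 1; this form makes the degeneracy relation
    -- of `β` applicable.
    have h₁ : (collapse k).comp (Fin.predAboveOrderHom 0) =
        (Fin.predAboveOrderHom (0 : Fin (1 + 1))).comp (consZero (collapse k)) := by
      ext x
      cases x using Fin.cases with
      | zero => rfl
      | succ x =>
        cases x using Fin.cases with
        | zero => rfl
        | succ x => simp [collapse_apply]
    rw [hb.pull_contraction _ hx, h₁, hb.pull_degeneracy_comp, Mor.pull_shift_eq_shift_shift _ h₀,
      Mor.shift_comp (hb.comp_cond hx), Mor.id_mul_comp (by simp [hb.cod_pull_collapse, hx]),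
      Mor.assoc (by simp [hb.cod_pull_collapse, hb.dom_pull])
        (by simp [hb.cod_pull_collapse, hx, h₀']), h₀', Mor.shift_mul, ← mul_assoc,
      Mor.shift_id, Mor.id_mul_id]
    rfl
  s_succ {k} x i := by
    refine Hom.ext ?_
    obtain ⟨x, hx, hx'⟩ := x
    exact hb.pull_contraction_of_succ (φ := Fin.predAboveOrderHom i.succ)
      (θ := Fin.predAboveOrderHom i) (by simp) (by simp) hx

theorem isLeftContraction_contraction (j : ℕ) :
    IsLeftContraction (TW (j + 2)) (TW.vertex j) (TW.contraction j) :=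
  isLeftContraction_of_isBraiding (beta j) (isBraiding_braid j)

/-- A simplicial set with a left contraction is contractible. -/
theorem IsLeftContraction.isContractible {X : SSet.{0}} {pt : X _⦋0⦌}
    {s : ∀ {k : ℕ}, X _⦋k⦌ → X _⦋k + 1⦌} (h : IsLeftContraction X pt s) : IsContractible X := by
  let A : SimplicialObject.Augmented (Type 0) :=
    { left := X
      right := PUnit
      hom := { app := fun _ => ↾fun _ => PUnit.unit } }
  let E : A.ExtraDegeneracy :=
    { s' := ↾fun _ => pt
      s := fun n => ↾fun x => s x
      s'_comp_ε := by ext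
      s₀_comp_δ₁ := by ext x; exact h.d_one x
      s_comp_δ₀ := fun n => by ext x; exact h.d_zero x
      s_comp_δ := fun n i => by ext x; exact h.d_succ x i
      s_comp_σ := fun n i => by ext x; exact h.s_succ x i }
  -- The homotopy supplied by an extra degeneracy starts at the map through the augmentation. It is
  -- constant at `pt` because there is only one map to `⦋0⦌`.
  have e : A.hom ≫ E.section_ = SSet.const pt := by
    ext n x
    refine congrArg (fun f : n.unop ⟶ ⦋0⦌ => X.map f.op pt) ?_
    exact Subsingleton.elim _ _
  refine ⟨pt, .rel _ _ ⟨?_⟩⟩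
  rw [← e]
  exact E.homotopy

theorem isContractible_TW (n : ℕ) : IsContractible (TW n) := by
  match n with
  | 0 => exact (isLeftContraction_of_isBraiding ⟨Mor.u 0, rfl, rfl⟩ isBraiding_u).isContractible
  | 1 =>
    exact (isLeftContraction_of_isBraiding ⟨Mor.id [0, 1], rfl, rfl⟩ isBraiding_id).isContractible
  | j + 2 => exact (isLeftContraction_contraction j).isContractible

end TwistOperad

/-! ### The nonsymmetric operad structure -/

open CategoryTheory Simplicial

/-- `finSigmaFinEquiv` lists the pairs lexicographically. The induction removes the last block,
since the position of `(i, j)` depends only on the lengths of the blocks before `i`. -/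
theorem ofFn_finSigmaFinEquiv_symm {α : Type*} {n : ℕ} (m : Fin n → ℕ)
    (F : (i : Fin n) × Fin (m i) → α) :
    List.ofFn (fun q => F (finSigmaFinEquiv.symm q)) =
      (List.ofFn fun i => List.ofFn fun j => F ⟨i, j⟩).flatten := by
  induction n with
  | zero => rfl
  | succ n ih =>
    have e₁ (p : (i : Fin n) × Fin (m i.castSucc)) :
        finSigmaFinEquiv (n := m) ⟨p.1.castSucc, p.2⟩ =
          Fin.cast (Fin.sum_univ_castSucc m).symm (Fin.castAdd _ (finSigmaFinEquiv p)) :=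
      Fin.ext (by simp only [finSigmaFinEquiv_apply, Fin.val_cast, Fin.val_castAdd]; rfl)
    have e₂ (j : Fin (m (Fin.last n))) :
        finSigmaFinEquiv (n := m) ⟨Fin.last n, j⟩ =
          Fin.cast (Fin.sum_univ_castSucc m).symm (Fin.natAdd _ j) :=
      Fin.ext (by simp only [finSigmaFinEquiv_apply, Fin.val_cast, Fin.val_natAdd]; rfl)
    rw [List.ofFn_congr (Fin.sum_univ_castSucc m), List.ofFn_add, List.ofFn_succ' (n := n),
      List.concat_eq_append, List.flatten_append,
      ← ih (fun i => m i.castSucc) fun p => F ⟨p.1.castSucc, p.2⟩]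
    congr 1
    · refine congrArg List.ofFn (funext fun q => congrArg F ?_)
      rw [Equiv.symm_apply_eq, e₁, Equiv.apply_symm_apply]
      rfl
    · rw [List.flatten_singleton]
      refine congrArg List.ofFn (funext fun j => congrArg F ?_)
      rw [Equiv.symm_apply_eq, e₂]

namespace TwistOperad

variable {k : ℕ}

namespace Mor

theorem cod_prod_ofFn {n : ℕ} (f : Fin n → Mor k) :
    (List.ofFn f).prod.cod = (List.ofFn fun i => (f i).cod).flatten := by
  induction n with
  | zero => rfl
  | succ n ih => simp [List.ofFn_succ, ih]

theorem dom_prod_ofFn {n : ℕ} (f : Fin n → Mor k) :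
    (List.ofFn f).prod.dom = (List.ofFn fun i => (f i).dom).flatten := by
  induction n with
  | zero => rfl
  | succ n ih => simp [List.ofFn_succ, ih]

theorem prod_ofFn_comp {n : ℕ} {f g : Fin n → Mor k} (h : ∀ i, (f i).cod = (g i).dom) :
    (List.ofFn f).prod.comp (List.ofFn g).prod = (List.ofFn fun i => (f i).comp (g i)).prod := by
  induction n with
  | zero => exact one_comp_one
  | succ n ih =>
    simp only [List.ofFn_succ, List.prod_cons]
    rw [interchange (h 0) (by simp [cod_prod_ofFn, dom_prod_ofFn, h]), ih fun i => h i.succ]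

theorem pull_prod_ofFn {l : ℕ} (θ : Fin (l + 1) →o Fin (k + 1)) {n : ℕ} (f : Fin n → Mor k) :
    (List.ofFn f).prod.pull θ = (List.ofFn fun i => (f i).pull θ).prod := by
  induction n with
  | zero => rfl
  | succ n ih => simp [List.ofFn_succ, ih]

end Mor

/-- The casts between equal words do not change the underlying element of `Mor k`, so an iterated
`⊔` is a product in a monoid. -/
theorem coe_tensorAll {n : ℕ} (m : Fin n → ℕ)
    (y : ∀ i, Hom (pow k (m i)) (List.finRange (k + 1))) :
    (tensorAll m y).1 = (List.ofFn fun i => (y i).1).prod := by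
  induction n with
  | zero => rfl
  | succ n ih =>
    rw [List.ofFn_succ, List.prod_cons, ← ih]
    rfl

/-- The type `Mor k` does not depend on domain or codomain, so operations of propositionally equal
arity can be compared there without transport. -/
theorem sigma_TW_ext {n n' : ℕ} {x : (TW n) _⦋k⦌} {x' : (TW n') _⦋k⦌} (hn : n = n')
    (h : x.1 = x'.1) : (⟨n, x⟩ : Σ n, (TW n) _⦋k⦌) = ⟨n', x'⟩ := by
  subst hn
  exact congrArg _ (Hom.ext h)

theorem coe_TW_comp {n : ℕ} (m : Fin n → ℕ) (x : (TW n) _⦋k⦌) (y : ∀ i, (TW (m i)) _⦋k⦌) :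
    (TW.comp m x y).1 = (List.ofFn fun i => (y i).1).prod.comp x.1 :=
  congrArg (fun f => Mor.comp f x.1) (coe_tensorAll m y)

theorem cod_prod_ofFn_TW {n : ℕ} (m : Fin n → ℕ) (x : (TW n) _⦋k⦌) (y : ∀ i, (TW (m i)) _⦋k⦌) :
    (List.ofFn fun i => (y i).1).prod.cod = x.1.dom :=
  (congrArg Mor.cod (coe_tensorAll m y)).symm.trans ((tensorAll m y).2.2.trans x.2.1.symm)

theorem isNonsymmetricOperad_TW : IsNonsymmetricOperad TW TW.unit TW.comp where
  map_unit {k l} θ := Hom.ext (congrArg Mor.id (pullWord_finRange _))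
  map_comp {k l} θ n m x y := by
    refine Hom.ext ?_
    rw [coe_TW_comp]
    change (TW.comp m x y).1.pull θ.toOrderHom = (List.ofFn fun i => (y i).1.pull _).prod.comp _
    rw [coe_TW_comp, Mor.pull_comp _ (cod_prod_ofFn_TW m x y), Mor.pull_prod_ofFn]
    rfl
  unit_comp {k n} x := by
    refine sigma_TW_ext (by simp) ?_
    rw [coe_TW_comp, List.ofFn_succ, List.ofFn_zero, List.prod_singleton]
    exact Mor.comp_id x.2.2
  comp_unit {k n} x := by
    refine sigma_TW_ext (by simp) ?_
    have h : (List.ofFn fun _ : Fin n => (TW.unit k).1).prod = Mor.id (pow k n) := by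
      clear x
      induction n with
      | zero => rfl
      | succ n ih =>
        rw [List.ofFn_succ, List.prod_cons, ih]
        exact (Mor.id_mul_id _ _).trans (congrArg Mor.id (pow_succ k n).symm)
    rw [coe_TW_comp, h]
    exact Mor.id_comp x.2.1
  assoc {k n} m l x y z := by
    refine sigma_TW_ext ?_ ?_
    · rw [← Fintype.sum_sigma' l]
      exact finSigmaFinEquiv.symm.sum_comp fun p => l p.1 p.2
    · have h (i : Fin n) : (List.ofFn fun j => (z i j).1).prod.cod = (y i).1.dom :=
        cod_prod_ofFn_TW (l i) (y i) (z i)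
      simp only [coe_TW_comp]
      -- The `n`-ary interchange law separates the `z` layer from the `y` layer, and the single
      -- product over all pairs becomes a product of block products; what remains is associativity
      -- of composition.
      rw [← Mor.prod_ofFn_comp h, ofFn_finSigmaFinEquiv_symm m fun p => (z p.1 p.2).1,
        List.prod_flatten, List.map_ofFn]
      refine (Mor.assoc ?_ (cod_prod_ofFn_TW m x y)).symm
      simp [Mor.cod_prod_ofFn, Mor.dom_prod_ofFn, ← h]

end TwistOperad

theorem theorem2p7 :
    TwistOperad.IsAInftyOperad TwistOperad.TW TwistOperad.TW.unit TwistOperad.TW.comp ∧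
    ∀ j : ℕ, TwistOperad.IsLeftContraction (TwistOperad.TW (j + 2))
      (TwistOperad.TW.vertex j) (TwistOperad.TW.contraction j) :=
  ⟨⟨TwistOperad.isNonsymmetricOperad_TW, TwistOperad.isContractible_TW⟩,
    TwistOperad.isLeftContraction_contraction⟩
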